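/- Let $X$ be a $\mathcal D_1$-space: a set with a maximal atlas $\Phi$ of charts $k\colon U\to X$, where $U\subset\mathbb R$ is open and $k$ is any map, such that $X$ is the colimit of the domains $U$ over the category of charts in $\Phi$; a morphism $(U_1,k_1)\to(U_2,k_2)$ is a smooth map $m\colon U_1\to U_2$ with nowhere vanishing derivative and $k_2\circ m=k_1$. Maximality means: $\Phi$ is closed under composition of charts with étale maps, and a map that is locally a chart in $\Phi$ belongs to $\Phi$. For $r\in\{2,\infty\}$ and $U\subset\mathbb R$ open, let $S_r(U)$ be the space of $r$-jets at $0$ of maps $f\colon(\mathbb R,0)\to U$ regular at $0$, with coordinates $z_p=f^{(p)}(0)$, $0\le p\le r$. The group $\mathrm{GL}(1)=\mathbb R^*$ acts on it by $z_p\mapsto\lambda^pz_p$. Let $S_r''(U)=S_r(U)/\mathrm O(1)$, with coordinates $x_0=z_0$, $x_1=\ln|z_1|$, $x_p=z_p/z_1^p$ $(p\ge2)$, and $S_r'(U)=S_r(U)/\mathrm{GL}(1)$, with coordinates $x_0,x_2,x_3,\dots$. The group $\mathbb Z$ acts on $S_r''(U)$ by $x_1\mapsto x_1+n$ (the action of $e^n\in\mathrm{GL}(1)$).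 Composition of jets with étale maps makes these spaces functorial in $U$. For $r=\infty$, differential forms are those which locally are smooth forms in finitely many of the coordinates. The complex $\Omega^*(S_r'(X))$ (resp. $\Omega^*(S_r''(X)/\mathbb Z)$) consists of the families of forms on $S_r'(U)$ (resp. of $\mathbb Z$-invariant forms on $S_r''(U)$), indexed by the charts $(U,k)\in\Phi$, that are preserved by pull-back along the maps induced by all morphisms of charts; $H^*$ denotes its cohomology with respect to the exterior derivative. Let $\theta_0,\theta_1,\theta_2,\dots$ be the canonical one-forms on frames, the components of the Gelfand–Kazhdan form $\theta=\sum_k\frac1{k!}\theta_kt^k\frac d{dt}$, $\theta(\tau)=-j_0\frac{d}{du}\big|_{u=0}(f_0^{-1}\circ f_u)$, where $\tau$ is the tangent vector at $u=0$ to the curve of jets of maps $f_u$. The form $\theta_0\wedge\theta_1\wedge\theta_2$ descends to a closed form in $\Omega^3(S_r''(X)/\mathbb Z)$, in coordinates $-dx_0\wedge dx_1\wedge dx_2$, and its class is the Godbillon–Vey–Losik (GVL) class of $X$ in $H^3(S_r''(X)/\mathbb Z)$; the form $\theta_2\wedge\theta_0$ descends to a closed form in $\Omega^2(S_r'(X))$,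 in coordinates $dx_2\wedge dx_0$, and its class is the first Chern–Losik (CL) class of $X$ in $H^2(S_r'(X))$. Write $S''=S''_\infty$ and $S'=S'_\infty$. **Proposition.** If the GVL class of $X$ is trivial in $H^3(S''(X)/\mathbb Z)$, then the first CL class of $X$ is trivial in $H^2(S'(X))$. If the GVL class of $X$ is trivial in $H^3(S_2''(X)/\mathbb Z)$, then the first CL class of $X$ is trivial in $H^2(S_2'(X))$. -/

import Mathlib

open scoped ContDiff Topology

noncomputable section

namespace Losik

universe u

/-! ### `𝒟₁`-spaces -/

/-- A `𝒟₁`-chart on a set `X`: an open subset of `ℝ` with an arbitrary map to `X`. -/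
structure Chart (X : Type u) where
  dom : TopologicalSpace.Opens ℝ
  map : dom → X

/-- `m` restricts to an étale (smooth and regular) map `U → V`; its values off `U` are
irrelevant. -/
structure IsEtale (U V : TopologicalSpace.Opens ℝ) (m : ℝ → ℝ) : Prop where
  mapsTo : ∀ x ∈ U, m x ∈ V
  smooth : ContDiffOn ℝ ∞ m U
  regular : ∀ x ∈ U, deriv m x ≠ 0

/-- The chart `(U, k ∘ m)` obtained from a chart `(V, k)` and an étale map `m : U → V`. -/
def Chart.pullback {X : Type u} (c : Chart X) {U : TopologicalSpace.Opens ℝ} {m : ℝ → ℝ}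
    (hm : IsEtale U c.dom m) : Chart X where
  dom := U
  map := fun x => c.map ⟨m x, hm.mapsTo x x.2⟩

/-- The restriction of a chart to a smaller open set. -/
def Chart.restrict {X : Type u} (c : Chart X) (V : TopologicalSpace.Opens ℝ) (h : V ≤ c.dom) :
    Chart X where
  dom := V
  map := fun x => c.map ⟨x, h x.2⟩

/-- A morphism of charts `(U₁, k₁) → (U₂, k₂)`: an étale map `m` with `k₂ ∘ m = k₁`. -/
structure IsChartMorphism {X : Type u} (c₁ c₂ : Chart X) (m : ℝ → ℝ) : Prop where
  etale : IsEtale c₁.dom c₂.dom m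
  comm : ∀ x : c₁.dom, c₂.map ⟨m x, etale.mapsTo x x.2⟩ = c₁.map x

/-- The relation on `∐ U` (over the charts `(U, k)` in `A`) whose quotient is the colimit, over the
category of all charts in `A` and all their morphisms, of the domains of the charts. -/
def GlueRel {X : Type u} (A : Set (Chart X)) (p q : Σ c : A, c.1.dom) : Prop :=
  ∃ m : ℝ → ℝ, IsChartMorphism p.1.1 q.1.1 m ∧ m p.2 = q.2

/-- The canonical map from that colimit to `X`. -/
def glueMap {X : Type u} (A : Set (Chart X)) : Quot (GlueRel A) → X :=
  Quot.lift (fun p => p.1.1.map p.2) (by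
    rintro ⟨c, x⟩ ⟨c', x'⟩ ⟨m, hm, hx⟩
    have h := hm.comm x
    have h' : (⟨m x, hm.etale.mapsTo x x.2⟩ : c'.1.dom) = x' := Subtype.ext hx
    rw [h'] at h
    exact h.symm)

/-- The structure of a `𝒟₁`-space on a set `X`: a maximal `𝒟₁`-atlas. -/
structure D1Space (X : Type u) where
  atlas : Set (Chart X)
  /-- `X` is the colimit of the domains of the charts. -/
  colimit : Function.Bijective (glueMap atlas)
  /-- Maximality, first condition: stability under étale maps. -/
  pullback_mem : ∀ c ∈ atlas, ∀ (U : TopologicalSpace.Opens ℝ) (m : ℝ → ℝ)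
    (hm : IsEtale U c.dom m), c.pullback hm ∈ atlas
  /-- Maximality, second condition: a map that is locally a chart of the atlas is one. -/
  local_mem : ∀ c : Chart X,
    (∀ x ∈ c.dom, ∃ (V : TopologicalSpace.Opens ℝ) (h : V ≤ c.dom), x ∈ V ∧
      c.restrict V h ∈ atlas) → c ∈ atlas

/-! ### Differential forms on open subsets of `ℝ^ι`, where `ι` may be infinite -/

/-- A field of alternating `k`-forms on `ι → ℝ`. -/
abbrev FormField (ι : Type) (k : ℕ) : Type := (ι → ℝ) → (ι → ℝ) [⋀^Fin k]→ₗ[ℝ] ℝ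

/-- The projection of `ℝ^ι` to a finite set of coordinates. -/
def proj {ι : Type} (s : Finset ι) : (ι → ℝ) →ₗ[ℝ] (s → ℝ) :=
  LinearMap.funLeft ℝ ℝ Subtype.val

/-- `φ` is a smooth form on `W`: locally it is the pull-back of a smooth form (one with smooth
coefficients) under the projection to finitely many coordinates. If `ι` is finite, this is
smoothness in the usual sense. -/
def IsSmoothForm {ι : Type} {k : ℕ} (W : Set (ι → ℝ)) (φ : FormField ι k) : Prop :=
  ∀ x ∈ W, ∃ (s : Finset ι) (V : Set (s → ℝ)) (η : (s → ℝ) → (s → ℝ) [⋀^Fin k]→ₗ[ℝ] ℝ),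
    IsOpen V ∧ proj s x ∈ V ∧ (∀ v, ContDiffOn ℝ ∞ (fun y => η y v) V) ∧
    ∀ y ∈ W, proj s y ∈ V → φ y = (η (proj s y)).compLinearMap (proj s)

/-- The tangent map of `F : ℝ^ι → ℝ^κ` at `x`, coordinate by coordinate. -/
def tangentMap {ι κ : Type} (F : (ι → ℝ) → (κ → ℝ)) (x v : ι → ℝ) : κ → ℝ :=
  fun p => lineDeriv ℝ (fun y => F y p) x v

/-- The pull-back `F^* φ`, evaluated at the point `x` on the vectors `v`. -/
def pullbackForm {ι κ : Type} {k : ℕ} (F : (ι → ℝ) → (κ → ℝ)) (φ : FormField κ k)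
    (x : ι → ℝ) (v : Fin k → ι → ℝ) : ℝ :=
  φ (F x) (fun i => tangentMap F x (v i))

/-- The exterior derivative
`dφ (v₀, …, v_k) = ∑ i, (-1)^i ∂_{v_i} (φ (v₀, …, v_{i-1}, v_{i+1}, …, v_k))`
at the point `x`. -/
def extD {ι : Type} {k : ℕ} (φ : FormField ι k) (x : ι → ℝ) (v : Fin (k + 1) → ι → ℝ) : ℝ :=
  ∑ i : Fin (k + 1), (-1 : ℝ) ^ (i : ℕ) * lineDeriv ℝ (fun y => φ y (i.removeNth v)) x (v i)

/-- The wedge product of one-forms,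
`(α₁ ∧ ⋯ ∧ α_k) (v₁, …, v_k) = det (α_j (v_i))`. -/
def wedge {E : Type} [AddCommGroup E] [Module ℝ E] {k : ℕ} (α : Fin k → E →ₗ[ℝ] ℝ) :
    E [⋀^Fin k]→ₗ[ℝ] ℝ :=
  Matrix.detRowAlternating.compLinearMap (LinearMap.pi α)

theorem isSmoothForm_zero {ι : Type} {k : ℕ} (W : Set (ι → ℝ)) :
    IsSmoothForm W (0 : FormField ι k) := fun x _ =>
  ⟨∅, Set.univ, 0, isOpen_univ, trivial, fun _ => contDiffOn_const, fun _ _ _ => by ext; simp⟩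

theorem IsSmoothForm.add {ι : Type} {k : ℕ} {W : Set (ι → ℝ)} {φ ψ : FormField ι k}
    (hφ : IsSmoothForm W φ) (hψ : IsSmoothForm W ψ) : IsSmoothForm W (φ + ψ) := by
  classical
  intro x hx
  obtain ⟨s, V, η, hV, hxV, hη, h⟩ := hφ x hx
  obtain ⟨s', V', η', hV', hxV', hη', h'⟩ := hψ x hx
  let a : ((s ∪ s' : Finset ι) → ℝ) →ₗ[ℝ] (s → ℝ) :=
    LinearMap.funLeft ℝ ℝ (fun i => ⟨i, Finset.mem_union_left _ i.2⟩)
  let b : ((s ∪ s' : Finset ι) → ℝ) →ₗ[ℝ] (s' → ℝ) :=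
    LinearMap.funLeft ℝ ℝ (fun i => ⟨i, Finset.mem_union_right _ i.2⟩)
  have ha : ContDiff ℝ ∞ a := (LinearMap.toContinuousLinearMap a).contDiff
  have hb : ContDiff ℝ ∞ b := (LinearMap.toContinuousLinearMap b).contDiff
  refine ⟨s ∪ s', a ⁻¹' V ∩ b ⁻¹' V',
    fun y => (η (a y)).compLinearMap a + (η' (b y)).compLinearMap b,
    (hV.preimage ha.continuous).inter (hV'.preimage hb.continuous), ⟨hxV, hxV'⟩, ?_, ?_⟩
  · intro v
    exact ((hη _).comp ha.contDiffOn fun y hy => hy.1).add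
      ((hη' _).comp hb.contDiffOn fun y hy => hy.2)
  · intro y hy hyV
    ext v
    have e1 := h y hy hyV.1
    have e2 := h' y hy hyV.2
    simp only [Pi.add_apply, AlternatingMap.add_apply, e1, e2]
    rfl

theorem IsSmoothForm.smul {ι : Type} {k : ℕ} {W : Set (ι → ℝ)} {φ : FormField ι k} (a : ℝ)
    (hφ : IsSmoothForm W φ) : IsSmoothForm W (a • φ) := by
  intro x hx
  obtain ⟨s, V, η, hV, hxV, hη, h⟩ := hφ x hx
  refine ⟨s, V, a • η, hV, hxV, fun v => (contDiffOn_const (c := a)).mul (hη v),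
    fun y hy hyV => ?_⟩
  ext v
  simp [h y hy hyV]

/-- The coefficients of a smooth form are differentiable along lines. -/
theorem IsSmoothForm.lineDifferentiableAt {ι : Type} {k : ℕ} {W : Set (ι → ℝ)} (hW : IsOpen W)
    {φ : FormField ι k} (hφ : IsSmoothForm W φ) {x : ι → ℝ} (hx : x ∈ W) (w : Fin k → ι → ℝ)
    (v : ι → ℝ) : LineDifferentiableAt ℝ (fun y => φ y w) x v := by
  obtain ⟨s, V, η, hV, hxV, hη, h⟩ := hφ x hx
  have hc : Continuous fun t : ℝ => x + t • v := by fun_prop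
  have hp : Continuous (proj s) := by
    unfold proj
    exact continuous_pi fun i => continuous_apply _
  have hev : (fun t : ℝ => φ (x + t • v) w) =ᶠ[𝓝 0]
      fun t => η (proj s x + t • proj s v) (fun i => proj s (w i)) := by
    have h1 : ∀ᶠ t : ℝ in 𝓝 0, x + t • v ∈ W :=
      hc.continuousAt.eventually_mem (by simpa using hW.mem_nhds hx)
    have h2 : ∀ᶠ t : ℝ in 𝓝 0, proj s (x + t • v) ∈ V :=
      (hp.comp hc).continuousAt.eventually_mem (by simpa using hV.mem_nhds hxV)
    filter_upwards [h1, h2] with t ht1 ht2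
    rw [h _ ht1 ht2, map_add, map_smul]
    rfl
  refine DifferentiableAt.congr_of_eventuallyEq ?_ hev
  have hd : DifferentiableAt ℝ (fun y => η y (fun i => proj s (w i)))
      (proj s x + (0 : ℝ) • proj s v) := by
    rw [zero_smul, add_zero]
    exact ((hη _).contDiffAt (hV.mem_nhds hxV)).differentiableAt (by simp)
  exact hd.comp (0 : ℝ) (f := fun t : ℝ => proj s x + t • proj s v) (by fun_prop)

theorem extD_zero {ι : Type} {k : ℕ} (x : ι → ℝ) (v : Fin (k + 1) → ι → ℝ) :
    extD (0 : FormField ι k) x v = 0 := by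
  simp [extD, lineDeriv]

theorem extD_add {ι : Type} {k : ℕ} {W : Set (ι → ℝ)} (hW : IsOpen W) {φ ψ : FormField ι k}
    (hφ : IsSmoothForm W φ) (hψ : IsSmoothForm W ψ) {x : ι → ℝ} (hx : x ∈ W)
    (v : Fin (k + 1) → ι → ℝ) : extD (φ + ψ) x v = extD φ x v + extD ψ x v := by
  unfold extD
  rw [← Finset.sum_add_distrib]
  refine Finset.sum_congr rfl fun i _ => ?_
  rw [← mul_add]
  congr 1
  exact deriv_add (hφ.lineDifferentiableAt hW hx _ _) (hψ.lineDifferentiableAt hW hx _ _)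

theorem extD_smul {ι : Type} {k : ℕ} (a : ℝ) (φ : FormField ι k) (x : ι → ℝ)
    (v : Fin (k + 1) → ι → ℝ) : extD (a • φ) x v = a * extD φ x v := by
  unfold extD
  rw [Finset.mul_sum]
  refine Finset.sum_congr rfl fun i _ => ?_
  have : lineDeriv ℝ (fun y => (a • φ) y (i.removeNth v)) x (v i) =
      a * lineDeriv ℝ (fun y => φ y (i.removeNth v)) x (v i) :=
    deriv_const_mul_field (v := fun t : ℝ => φ (x + t • v i) (i.removeNth v)) a
  rw [this]
  ring

theorem wedge_apply {E : Type} [AddCommGroup E] [Module ℝ E] {k : ℕ} (α : Fin k → E →ₗ[ℝ] ℝ)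
    (v : Fin k → E) : wedge α v = Matrix.det (Matrix.of fun i j => α j (v i)) := rfl

/-- Constant combinations of the coordinate forms are smooth. -/
theorem isSmoothForm_const {ι : Type} {k : ℕ} {W : Set (ι → ℝ)} {φ : FormField ι k} (a : ℝ)
    (p : Fin k → ι) (h : ∀ y ∈ W, φ y = a • wedge fun j => LinearMap.proj (p j)) :
    IsSmoothForm W φ := by
  classical
  refine fun x _ => ⟨Finset.univ.image p, Set.univ, fun _ => a • wedge fun j =>
    LinearMap.proj ⟨p j, Finset.mem_image_of_mem p (Finset.mem_univ j)⟩, isOpen_univ, trivial,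
    fun _ => contDiffOn_const, fun y hy _ => ?_⟩
  rw [h y hy]
  rfl

theorem extD_const {ι : Type} {k : ℕ} {W : Set (ι → ℝ)} (hW : IsOpen W) {φ : FormField ι k}
    {K : (ι → ℝ) [⋀^Fin k]→ₗ[ℝ] ℝ} (h : ∀ y ∈ W, φ y = K) {x : ι → ℝ} (hx : x ∈ W)
    (v : Fin (k + 1) → ι → ℝ) : extD φ x v = 0 := by
  refine Finset.sum_eq_zero fun i _ => ?_
  have hc : Continuous fun t : ℝ => x + t • v i := by fun_prop
  have h1 : ∀ᶠ t : ℝ in 𝓝 0, x + t • v i ∈ W :=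
    hc.continuousAt.eventually_mem (by simpa using hW.mem_nhds hx)
  have h2 : (fun t : ℝ => φ (x + t • v i) (i.removeNth v)) =ᶠ[𝓝 0]
      fun _ => K (i.removeNth v) := by
    filter_upwards [h1] with t ht
    rw [h _ ht]
  rw [lineDeriv, h2.deriv_eq, deriv_const, mul_zero]

/-- A category of charts with open domains in `ℝ^ι`, given by its objects and its morphisms. -/
structure ChartSystem (ι : Type) where
  Obj : Type u
  dom : Obj → Set (ι → ℝ)
  isOpen_dom : ∀ c, IsOpen (dom c)
  Mor : Obj → Obj → Set ((ι → ℝ) → (ι → ℝ))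

/-- The families of fields of `k`-forms indexed by the charts. -/
def FormFamily {ι : Type} (Y : ChartSystem.{u} ι) (k : ℕ) : Type u := Y.Obj → FormField ι k

instance {ι : Type} (Y : ChartSystem.{u} ι) (k : ℕ) : AddCommGroup (FormFamily Y k) :=
  inferInstanceAs (AddCommGroup (Y.Obj → FormField ι k))

instance {ι : Type} (Y : ChartSystem.{u} ι) (k : ℕ) : Module ℝ (FormFamily Y k) :=
  inferInstanceAs (Module ℝ (Y.Obj → FormField ι k))

/-- The space `Ω^k` of a category of charts: families of smooth `k`-forms on the domains of the
charts that are preserved by all morphisms (normalized by `0` off the domains). -/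
def Forms {ι : Type} (Y : ChartSystem.{u} ι) (k : ℕ) : Submodule ℝ (FormFamily Y k) where
  carrier := {φ | (∀ c, IsSmoothForm (Y.dom c) (φ c)) ∧ (∀ c, ∀ x ∉ Y.dom c, φ c x = 0) ∧
    ∀ c c', ∀ F ∈ Y.Mor c c', ∀ x ∈ Y.dom c, ∀ v, pullbackForm F (φ c') x v = φ c x v}
  zero_mem' := ⟨fun c => isSmoothForm_zero _, fun _ _ _ => rfl, fun _ _ _ _ _ _ _ => rfl⟩
  add_mem' := fun {φ ψ} hφ hψ => ⟨fun c => (hφ.1 c).add (hψ.1 c),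
    fun c x hx => by
      change φ c x + ψ c x = 0
      rw [hφ.2.1 c x hx, hψ.2.1 c x hx, add_zero],
    fun c c' F hF x hx v =>
      congrArg₂ (· + ·) (hφ.2.2 c c' F hF x hx v) (hψ.2.2 c c' F hF x hx v)⟩
  smul_mem' := fun a φ hφ => ⟨fun c => (hφ.1 c).smul a,
    fun c x hx => by
      change a • φ c x = 0
      rw [hφ.2.1 c x hx, smul_zero],
    fun c c' F hF x hx v => congrArg (a * ·) (hφ.2.2 c c' F hF x hx v)⟩

/-- The closed `k`-forms. -/
def Cocycles {ι : Type} (Y : ChartSystem.{u} ι) (k : ℕ) :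
    Submodule ℝ (FormFamily Y k) where
  carrier := {φ | φ ∈ Forms Y k ∧ ∀ c, ∀ x ∈ Y.dom c, ∀ v, extD (φ c) x v = 0}
  zero_mem' := ⟨(Forms Y k).zero_mem, fun _ x _ v => extD_zero x v⟩
  add_mem' := fun {φ ψ} hφ hψ => ⟨(Forms Y k).add_mem hφ.1 hψ.1, fun c x hx v => by
    have h := extD_add (Y.isOpen_dom c) (hφ.1.1 c) (hψ.1.1 c) hx v
    rw [hφ.2 c x hx v, hψ.2 c x hx v, add_zero] at h
    exact h⟩
  smul_mem' := fun a φ hφ => ⟨(Forms Y k).smul_mem a hφ.1, fun c x hx v => by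
    have h := extD_smul a (φ c) x v
    rw [hφ.2 c x hx v, mul_zero] at h
    exact h⟩

/-- The exact `k`-forms: the forms `α ∈ Ω^k` with `α = dβ` for some `β ∈ Ω^{k-1}`. -/
def Coboundaries {ι : Type} (Y : ChartSystem.{u} ι) :
    (k : ℕ) → Submodule ℝ (FormFamily Y k)
  | 0 => ⊥
  | k + 1 =>
    { carrier := {α | α ∈ Forms Y (k + 1) ∧
        ∃ β ∈ Forms Y k, ∀ c, ∀ x ∈ Y.dom c, ∀ v, extD (β c) x v = α c x v}
      zero_mem' := ⟨(Forms Y (k + 1)).zero_mem, 0, (Forms Y k).zero_mem,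
        fun _ x _ v => extD_zero x v⟩
      add_mem' := by
        rintro α α' ⟨hα, β, hβ, h⟩ ⟨hα', β', hβ', h'⟩
        refine ⟨(Forms Y (k + 1)).add_mem hα hα', β + β', (Forms Y k).add_mem hβ hβ',
          fun c x hx v => ?_⟩
        have e := extD_add (Y.isOpen_dom c) (hβ.1 c) (hβ'.1 c) hx v
        rw [h c x hx v, h' c x hx v] at e
        exact e
      smul_mem' := by
        rintro a α ⟨hα, β, hβ, h⟩
        refine ⟨(Forms Y (k + 1)).smul_mem a hα, a • β, (Forms Y k).smul_mem a hβ,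
          fun c x hx v => ?_⟩
        have e := extD_smul a (β c) x v
        rw [h c x hx v] at e
        exact e }

/-- The de Rham cohomology `H^k`: closed forms modulo exact forms. -/
abbrev Cohomology {ι : Type} (Y : ChartSystem.{u} ι) (k : ℕ) : Type u :=
  Cocycles Y k ⧸ (Coboundaries Y k).submoduleOf (Cocycles Y k)

/-- The cohomology class of a closed form. -/
def Cohomology.mk {ι : Type} (Y : ChartSystem.{u} ι) {k : ℕ} (φ : Cocycles Y k) :
    Cohomology Y k :=
  Submodule.Quotient.mk φ

/-! ### Frames of order `r ≤ ∞` and their quotients -/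

/-- The coordinate functions on `ℝ^I` for `I ⊆ ℕ`, extended by `0` to indices outside `I`. -/
def coord (I : Set ℕ) (p : ℕ) : (I → ℝ) →ₗ[ℝ] ℝ :=
  open Classical in if h : p ∈ I then LinearMap.proj ⟨p, h⟩ else 0

/-- The indices of the coordinates `z₀, z₁, z₂, …, z_r` on the space of frames of order `r`
and of the coordinates `x₀, x₁, x₂, …, x_r` on its quotient by `O(1)`. -/
def idx (r : ℕ∞) : Set ℕ := {p | (p : ℕ∞) ≤ r}

/-- The indices of the coordinates `x₀, x₂, x₃, …, x_r` on the quotient by `GL(1)`. -/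
def idxGL (r : ℕ∞) : Set ℕ := {p | (p : ℕ∞) ≤ r ∧ p ≠ 1}

/-- The space of frames of order `r` of `U`: the `r`-jets at `0` of smooth maps `f` from a
neighbourhood of `0` in `ℝ` to `U` that are regular at `0`. A jet is recorded by its derivatives
`z_p = f^{(p)}(0)`, `p ≤ r`, which can be prescribed arbitrarily subject to `z₀ ∈ U`, `z₁ ≠ 0`
(for `r = ∞` by Borel's lemma). -/
def Frames (r : ℕ∞) (U : TopologicalSpace.Opens ℝ) : Set (idx r → ℝ) :=
  {z | coord _ 0 z ∈ U ∧ coord _ 1 z ≠ 0}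

/-- The action of `GL(1) = ℝ^*` on frames by linear reparametrization. -/
def scale {r : ℕ∞} (a : ℝ) (z : idx r → ℝ) : idx r → ℝ := fun p => a ^ (p : ℕ) * z p

/-- The map of frames induced by `h`: the jet of `f` goes to the jet of `h ∘ f`, where for the
`p`-th derivative `f` may be replaced by its Taylor polynomial of order `p`. -/
def jetMap {r : ℕ∞} (h : ℝ → ℝ) (z : idx r → ℝ) : idx r → ℝ := fun p =>
  iteratedDeriv p
    (fun t => h (∑ j ∈ Finset.range ((p : ℕ) + 1), coord _ j z / (j.factorial : ℝ) * t ^ j)) 0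

/-- The projection `S(U) → S''(U) = S(U)/O(1)` in the coordinates
`x₀ = z₀`, `x₁ = ln |z₁|`, `x_p = z_p / z₁^p` on `S''(U)`. -/
def toO {r : ℕ∞} (z : idx r → ℝ) : idx r → ℝ := fun p =>
  if (p : ℕ) = 1 then Real.log |coord _ 1 z| else z p / coord _ 1 z ^ (p : ℕ)

/-- The section of `toO` with `z₁ > 0`. -/
def sectionO {r : ℕ∞} (x : idx r → ℝ) : idx r → ℝ := fun p =>
  if (p : ℕ) = 1 then Real.exp (coord _ 1 x) else Real.exp (coord _ 1 x) ^ (p : ℕ) * x p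

/-- The differential of `sectionO` at `x`. -/
def dSectionO {r : ℕ∞} (x : idx r → ℝ) : (idx r → ℝ) →ₗ[ℝ] (idx r → ℝ) :=
  LinearMap.pi fun p =>
    if (p : ℕ) = 1 then Real.exp (coord _ 1 x) • coord _ 1
    else Real.exp (coord _ 1 x) ^ (p : ℕ) • (LinearMap.proj p + ((p : ℕ) * x p) • coord _ 1)

/-- The projection `S(U) → S'(U) = S(U)/GL(1)` in the coordinates
`x₀ = z₀`, `x_p = z_p / z₁^p` (`p ≥ 2`) on `S'(U)`. -/
def toGL {r : ℕ∞} (z : idx r → ℝ) : idxGL r → ℝ := fun p =>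
  coord _ (p : ℕ) z / coord _ 1 z ^ (p : ℕ)

/-- The section of `toGL` with `z₁ = 1`. -/
def sectionGL {r : ℕ∞} (x : idxGL r → ℝ) : idx r → ℝ := fun p =>
  if (p : ℕ) = 1 then 1 else coord _ (p : ℕ) x

/-- The differential of `sectionGL`. -/
def dSectionGL {r : ℕ∞} : (idxGL r → ℝ) →ₗ[ℝ] (idx r → ℝ) :=
  LinearMap.pi fun p => coord _ (p : ℕ)

/-- The map `S''(h)` induced on the quotients by `O(1)`. -/
def mapO {r : ℕ∞} (h : ℝ → ℝ) (x : idx r → ℝ) : idx r → ℝ := toO (jetMap h (sectionO x))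

/-- The map `S'(h)` induced on the quotients by `GL(1)`. -/
def mapGL {r : ℕ∞} (h : ℝ → ℝ) (x : idxGL r → ℝ) : idxGL r → ℝ := toGL (jetMap h (sectionGL x))

/-- The action of `n ∈ ℤ`, that is of `e^n ∈ GL(1)`, on `S''(U)`: `x₁ ↦ x₁ + n`. -/
def shift {r : ℕ∞} (n : ℤ) (x : idx r → ℝ) : idx r → ℝ := fun p =>
  if (p : ℕ) = 1 then x p + n else x p

theorem coord_of_mem {I : Set ℕ} {p : ℕ} (h : p ∈ I) (x : I → ℝ) : coord I p x = x ⟨p, h⟩ := by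
  simp [coord, h]

theorem continuous_coord (I : Set ℕ) (p : ℕ) : Continuous fun x : I → ℝ => coord I p x := by
  by_cases h : p ∈ I
  · simp only [coord_of_mem h]
    exact continuous_apply _
  · simp only [coord, h, dite_false, LinearMap.zero_apply]
    exact continuous_const

theorem zero_mem_idx (r : ℕ∞) : 0 ∈ idx r := by simp [idx]

theorem zero_mem_idxGL (r : ℕ∞) : 0 ∈ idxGL r := by simp [idxGL]

theorem one_mem_idx {r : ℕ∞} (hr : 2 ≤ r) : 1 ∈ idx r := by
  simp only [idx, Set.mem_ofPred_eq]
  exact le_trans (by norm_num) hr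

theorem two_mem_idx {r : ℕ∞} (hr : 2 ≤ r) : 2 ∈ idx r := by
  simpa [idx] using hr

theorem two_mem_idxGL {r : ℕ∞} (hr : 2 ≤ r) : 2 ∈ idxGL r := by
  simpa [idxGL] using hr

theorem coord_tangentMap {ι : Type} {I : Set ℕ} (F : (ι → ℝ) → (I → ℝ)) (p : ℕ) (x v : ι → ℝ) :
    coord I p (tangentMap F x v) = lineDeriv ℝ (fun y => coord I p (F y)) x v := by
  by_cases h : p ∈ I
  · simp only [coord_of_mem h, tangentMap]
  · simp [coord, h, lineDeriv]

theorem coord_jetMap_zero {r : ℕ∞} (h : ℝ → ℝ) (z : idx r → ℝ) :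
    coord _ 0 (jetMap h z) = h (coord _ 0 z) := by
  rw [coord_of_mem (zero_mem_idx r)]
  simp [jetMap]

theorem coord_jetMap_one {r : ℕ∞} (hr : 2 ≤ r) {h : ℝ → ℝ} {z : idx r → ℝ}
    (hh : DifferentiableAt ℝ h (coord _ 0 z)) :
    coord _ 1 (jetMap h z) = deriv h (coord _ 0 z) * coord _ 1 z := by
  rw [coord_of_mem (one_mem_idx hr)]
  simp only [jetMap, iteratedDeriv_one, Finset.sum_range_succ, Finset.sum_range_zero]
  norm_num
  have h1 : HasDerivAt (fun t : ℝ => coord (idx r) 0 z + coord (idx r) 1 z * t)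
      (coord (idx r) 1 z) 0 := by
    simpa using ((hasDerivAt_id (0 : ℝ)).const_mul (coord (idx r) 1 z)).const_add
      (coord (idx r) 0 z)
  have h2 : HasDerivAt h (deriv h (coord (idx r) 0 z))
      (coord (idx r) 0 z + coord (idx r) 1 z * 0) := by
    simpa using hh.hasDerivAt
  exact (h2.comp 0 h1).deriv

theorem coord_jetMap_two {r : ℕ∞} (hr : 2 ≤ r) {h : ℝ → ℝ} {z : idx r → ℝ}
    {U : TopologicalSpace.Opens ℝ} (hU : coord _ 0 z ∈ U) (hh : ContDiffOn ℝ ∞ h U) :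
    coord _ 2 (jetMap h z) = deriv (deriv h) (coord _ 0 z) * coord _ 1 z ^ 2 +
      deriv h (coord _ 0 z) * coord _ 2 z := by
  rw [coord_of_mem (two_mem_idx hr)]
  simp only [jetMap, Finset.sum_range_succ, Finset.sum_range_zero]
  norm_num [Nat.factorial]
  set a := coord (idx r) 0 z
  set b := coord (idx r) 1 z
  set c := coord (idx r) 2 z
  have hp : ∀ t : ℝ, HasDerivAt (fun t : ℝ => a + b * t + c / 2 * t ^ 2) (b + c * t) t := by
    intro t
    have := (((hasDerivAt_id t).const_mul b).const_add a).add
      (((hasDerivAt_id t).pow 2).const_mul (c / 2))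
    exact this.congr_deriv (by simp only [id_eq, mul_one, Nat.cast_ofNat]; norm_num; ring)
  have hd : ContDiffOn ℝ ∞ (deriv h) U := hh.deriv_of_isOpen U.isOpen (by simp)
  have hev : ∀ᶠ t : ℝ in 𝓝 0, a + b * t + c / 2 * t ^ 2 ∈ U := by
    have : Continuous fun t : ℝ => a + b * t + c / 2 * t ^ 2 := by fun_prop
    exact this.continuousAt.eventually_mem (by simpa using U.isOpen.mem_nhds hU)
  have hev' : deriv (fun t : ℝ => h (a + b * t + c / 2 * t ^ 2)) =ᶠ[𝓝 0]
      fun t => deriv h (a + b * t + c / 2 * t ^ 2) * (b + c * t) := by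
    filter_upwards [hev] with t ht
    have h1 : HasDerivAt h (deriv h (a + b * t + c / 2 * t ^ 2)) (a + b * t + c / 2 * t ^ 2) :=
      ((hh.contDiffAt (U.isOpen.mem_nhds ht)).differentiableAt (by simp)).hasDerivAt
    exact (h1.comp t (hp t)).deriv
  rw [iteratedDeriv_succ, iteratedDeriv_one, hev'.deriv_eq]
  have h2 : HasDerivAt (deriv h) (deriv (deriv h) a) (a + b * 0 + c / 2 * 0 ^ 2) := by
    simpa using ((hd.contDiffAt (U.isOpen.mem_nhds hU)).differentiableAt (by simp)).hasDerivAt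
  have h3 := (h2.comp 0 (hp 0)).mul (((hasDerivAt_id (0 : ℝ)).const_mul c).const_add b)
  have h4 := h3.deriv
  simp only [id_eq, mul_zero, add_zero, mul_one] at h4
  rw [show (fun t => deriv h (a + b * t + c / 2 * t ^ 2) * (b + c * t)) =
    (deriv h ∘ fun t => a + b * t + c / 2 * t ^ 2) * fun t => b + c * t from rfl]
  refine h4.trans ?_
  simp
  ring

/-! The maps `toO` and `toGL` are the quotient maps by `O(1)` and `GL(1)`, and `mapO` and `mapGL`
are the maps induced on the quotients. -/

theorem coord_scale {r : ℕ∞} (a : ℝ) (p : ℕ) (z : idx r → ℝ) :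
    coord _ p (scale a z) = a ^ p * coord _ p z := by
  by_cases h : p ∈ idx r
  · simp [coord_of_mem h, scale]
  · simp [coord, h]

theorem sectionO_toO {r : ℕ∞} {z : idx r → ℝ} (hz : coord _ 1 z ≠ 0) :
    sectionO (toO z) = scale (|coord _ 1 z| / coord _ 1 z) z := by
  have h1 : 1 ∈ idx r := by
    by_contra h
    simp [coord, h] at hz
  have e : Real.exp (coord _ 1 (toO z)) = |coord _ 1 z| := by
    rw [coord_of_mem h1]
    simp only [toO, if_true]
    exact Real.exp_log (abs_pos.2 hz)
  funext p
  simp only [sectionO, e, scale]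
  split_ifs with hp
  · obtain ⟨p, hp'⟩ := p
    obtain rfl : p = 1 := hp
    rw [← coord_of_mem hp' z, pow_one]
    field_simp
  · simp only [toO, if_neg hp, div_pow]
    ring

theorem toO_sectionO {r : ℕ∞} (x : idx r → ℝ) : toO (sectionO x) = x := by
  funext p
  have e : ∀ h : 1 ∈ idx r, coord _ 1 (sectionO x) = Real.exp (coord _ 1 x) := fun h => by
    rw [coord_of_mem h]; simp [sectionO]
  simp only [toO]
  split_ifs with hp
  · obtain ⟨p, hp'⟩ := p
    obtain rfl : p = 1 := hp
    rw [e hp', abs_of_pos (Real.exp_pos _), Real.log_exp, coord_of_mem hp']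
  · by_cases h : 1 ∈ idx r
    · rw [e h]
      simp only [sectionO, if_neg hp]
      field_simp
    · have hp0 : (p : ℕ) = 0 := by
        by_contra h0
        refine h (show ((1 : ℕ) : ℕ∞) ≤ r from le_trans ?_ (show ((p : ℕ) : ℕ∞) ≤ r from p.2))
        exact_mod_cast Nat.one_le_iff_ne_zero.2 h0
      simp [sectionO, hp0]

theorem scale_scale {r : ℕ∞} (a b : ℝ) (z : idx r → ℝ) :
    scale a (scale b z) = scale (a * b) z := by
  funext p
  simp only [scale, mul_pow]
  ring

theorem scale_one {r : ℕ∞} (z : idx r → ℝ) : scale 1 z = z := by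
  funext p
  simp [scale]

theorem toO_scale {r : ℕ∞} {a : ℝ} (ha : a ^ 2 = 1) (z : idx r → ℝ) :
    toO (scale a z) = toO z := by
  have h0 : a ≠ 0 := by rintro rfl; norm_num at ha
  have h1 : |a| = 1 := (pow_eq_one_iff_of_nonneg (abs_nonneg a) two_ne_zero).1 (by rw [sq_abs, ha])
  funext p
  simp only [toO, coord_scale, pow_one, abs_mul, h1, one_mul, scale, mul_pow]
  rw [mul_div_mul_left _ _ (pow_ne_zero _ h0)]

theorem toGL_scale {r : ℕ∞} {a : ℝ} (ha : a ≠ 0) (z : idx r → ℝ) :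
    toGL (scale a z) = toGL z := by
  funext p
  simp only [toGL, coord_scale, pow_one, mul_pow]
  rw [mul_div_mul_left _ _ (pow_ne_zero _ ha)]

theorem sectionGL_toGL {r : ℕ∞} {z : idx r → ℝ} (hz : coord _ 1 z ≠ 0) :
    sectionGL (toGL z) = scale (coord _ 1 z)⁻¹ z := by
  funext p
  simp only [sectionGL, scale]
  split_ifs with hp
  · obtain ⟨p, hp'⟩ := p
    obtain rfl : p = 1 := hp
    rw [← coord_of_mem hp' z, pow_one, inv_mul_cancel₀ hz]
  · rw [coord_of_mem (show (p : ℕ) ∈ idxGL r from ⟨p.2, hp⟩)]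
    simp only [toGL, inv_pow]
    rw [coord_of_mem p.2, div_eq_inv_mul]

theorem sq_sign {a : ℝ} (ha : a ≠ 0) : (|a| / a) ^ 2 = 1 := by
  rw [div_pow, sq_abs, div_self (pow_ne_zero _ ha)]

/-- The fibres of `toO` on frames are the orbits of `O(1) = {a | a ^ 2 = 1}`. -/
theorem toO_eq_iff {r : ℕ∞} {z w : idx r → ℝ} (hz : coord _ 1 z ≠ 0) (hw : coord _ 1 w ≠ 0) :
    toO z = toO w ↔ ∃ a : ℝ, a ^ 2 = 1 ∧ w = scale a z := by
  constructor
  · intro h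
    have e : scale (|coord _ 1 z| / coord _ 1 z) z = scale (|coord _ 1 w| / coord _ 1 w) w := by
      rw [← sectionO_toO hz, ← sectionO_toO hw, h]
    refine ⟨|coord _ 1 w| / coord _ 1 w * (|coord _ 1 z| / coord _ 1 z), ?_, ?_⟩
    · rw [mul_pow, sq_sign hz, sq_sign hw, one_mul]
    · rw [← scale_scale, e, scale_scale, ← pow_two, sq_sign hw, scale_one]
  · rintro ⟨a, ha, rfl⟩
    exact (toO_scale ha z).symm

/-- The fibres of `toGL` on frames are the orbits of `GL(1)`. -/
theorem toGL_eq_iff {r : ℕ∞} {z w : idx r → ℝ} (hz : coord _ 1 z ≠ 0) (hw : coord _ 1 w ≠ 0) :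
    toGL z = toGL w ↔ ∃ a : ℝ, a ≠ 0 ∧ w = scale a z := by
  constructor
  · intro h
    have e : scale (coord _ 1 z)⁻¹ z = scale (coord _ 1 w)⁻¹ w := by
      rw [← sectionGL_toGL hz, ← sectionGL_toGL hw, h]
    refine ⟨coord _ 1 w * (coord _ 1 z)⁻¹, mul_ne_zero hw (inv_ne_zero hz), ?_⟩
    rw [← scale_scale, e, scale_scale, mul_inv_cancel₀ hw, scale_one]
  · rintro ⟨a, ha, rfl⟩
    exact (toGL_scale ha z).symm

theorem iteratedDeriv_comp_scale (n : ℕ) (g : ℝ → ℝ) (a : ℝ) :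
    iteratedDeriv n (fun t => g (a * t)) = fun t => a ^ n * iteratedDeriv n g (a * t) := by
  induction n with
  | zero => simp
  | succ n ih =>
    rw [iteratedDeriv_succ, ih]
    funext t
    rw [deriv_const_mul_field, deriv_comp_mul_left, iteratedDeriv_succ, smul_eq_mul]
    ring

theorem jetMap_scale {r : ℕ∞} (h : ℝ → ℝ) (a : ℝ) (z : idx r → ℝ) :
    jetMap h (scale a z) = scale a (jetMap h z) := by
  funext p
  have e : ∀ t : ℝ, ∑ j ∈ Finset.range ((p : ℕ) + 1),
      coord _ j (scale a z) / (j.factorial : ℝ) * t ^ j =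
      ∑ j ∈ Finset.range ((p : ℕ) + 1), coord _ j z / (j.factorial : ℝ) * (a * t) ^ j :=
    fun t => Finset.sum_congr rfl fun j _ => by rw [coord_scale, mul_pow]; ring
  simp only [jetMap, scale, e]
  rw [iteratedDeriv_comp_scale p (fun t => h (∑ j ∈ Finset.range ((p : ℕ) + 1),
    coord _ j z / (j.factorial : ℝ) * t ^ j)) a]
  simp only [mul_zero]

theorem mapO_toO {r : ℕ∞} (h : ℝ → ℝ) {z : idx r → ℝ} (hz : coord _ 1 z ≠ 0) :
    mapO h (toO z) = toO (jetMap h z) := by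
  rw [mapO, sectionO_toO hz, jetMap_scale, toO_scale (sq_sign hz)]

theorem mapGL_toGL {r : ℕ∞} (h : ℝ → ℝ) {z : idx r → ℝ} (hz : coord _ 1 z ≠ 0) :
    mapGL h (toGL z) = toGL (jetMap h z) := by
  rw [mapGL, sectionGL_toGL hz, jetMap_scale, toGL_scale (inv_ne_zero hz)]

/-- The action of `n ∈ ℤ` is induced by the action of `e^n ∈ GL(1)` on frames. -/
theorem shift_toO {r : ℕ∞} (n : ℤ) {z : idx r → ℝ} (hz : coord _ 1 z ≠ 0) :
    shift n (toO z) = toO (scale (Real.exp n) z) := by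
  funext p
  simp only [shift, toO, coord_scale, pow_one, abs_mul, scale, mul_pow]
  split_ifs with hp
  · rw [Real.log_mul (by simp) (by simpa using hz), abs_of_pos (Real.exp_pos _), Real.log_exp,
      add_comm]
  · rw [mul_div_mul_left _ _ (pow_ne_zero _ (Real.exp_ne_zero _))]

/-- The charts of `S''_r(X)/ℤ`: the sets `S''_r(U)` for the charts `(U, k)` of `X`, with the maps
induced by the morphisms of charts of `X` and by the action of `ℤ`. -/
def quotOZ {X : Type u} (D : D1Space X) (r : ℕ∞) : ChartSystem.{u} (idx r) where
  Obj := D.atlas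
  dom := fun c => {x | coord _ 0 x ∈ c.1.dom}
  isOpen_dom := fun c => c.1.dom.isOpen.preimage (continuous_coord _ 0)
  Mor := fun c c' => {F | ∃ m : ℝ → ℝ, IsChartMorphism c.1 c'.1 m ∧
    ∃ n : ℤ, F = fun x => shift n (mapO m x)}

/-- The charts of `S'_r(X)`: the sets `S'_r(U)` for the charts `(U, k)` of `X`, with the maps
induced by the morphisms of charts of `X`. -/
def quotGL {X : Type u} (D : D1Space X) (r : ℕ∞) : ChartSystem.{u} (idxGL r) where
  Obj := D.atlas
  dom := fun c => {x | coord _ 0 x ∈ c.1.dom}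
  isOpen_dom := fun c => c.1.dom.isOpen.preimage (continuous_coord _ 0)
  Mor := fun c c' => {F | ∃ m : ℝ → ℝ, IsChartMorphism c.1 c'.1 m ∧ F = mapGL m}

/-! ### Canonical forms and characteristic classes -/

/-- The canonical forms `θ₀, θ₁, θ₂, …` on frames, the components of the Gelfand–Kazhdan form
`θ = ∑ k, θ_k t^k/k! d/dt`: for the tangent vector `τ` of a curve of jets of maps `f_u` through
the jet `z` of `f = f₀`, `θ(τ) = - d/du (f⁻¹ ∘ f_u) = - (df_u/du) / f'`, as formal power series
in `t`. For finite `r` the jet is continued by zero derivatives; the products of canonical forms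
used below do not depend on derivatives of order more than two. -/
def theta {r : ℕ∞} (k : ℕ) (z : idx r → ℝ) : (idx r → ℝ) →ₗ[ℝ] ℝ where
  toFun τ := -(k.factorial * PowerSeries.coeff k
    (PowerSeries.mk (fun p => coord _ p τ / (p.factorial : ℝ)) *
      (PowerSeries.mk (fun p => coord _ (p + 1) z / (p.factorial : ℝ)))⁻¹))
  map_add' := fun σ τ => by
    have : PowerSeries.mk (fun p => coord _ p (σ + τ) / (p.factorial : ℝ)) =
        PowerSeries.mk (fun p => coord _ p σ / (p.factorial : ℝ)) +
        PowerSeries.mk (fun p => coord _ p τ / (p.factorial : ℝ)) := by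
      ext p
      simp [add_div]
    rw [this, add_mul, map_add]
    ring
  map_smul' := fun a τ => by
    have : PowerSeries.mk (fun p => coord _ p (a • τ) / (p.factorial : ℝ)) =
        a • PowerSeries.mk (fun p => coord _ p τ / (p.factorial : ℝ)) := by
      ext p
      simp [mul_div_assoc]
    rw [this, smul_mul_assoc, PowerSeries.coeff_smul, smul_eq_mul, RingHom.id_apply, smul_eq_mul]
    ring

/-- The form `θ₀ ∧ θ₁ ∧ θ₂` on `S''(U)`. -/
def gvlField {r : ℕ∞} : FormField (idx r) 3 := fun x =>
  (wedge ![theta 0 (sectionO x), theta 1 (sectionO x), theta 2 (sectionO x)]).compLinearMap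
    (dSectionO x)

/-- The form `θ₂ ∧ θ₀` on `S'(U)`. -/
def clField {r : ℕ∞} : FormField (idxGL r) 2 := fun x =>
  (wedge ![theta 2 (sectionGL x), theta 0 (sectionGL x)]).compLinearMap dSectionGL

/-! The canonical forms are computed in coordinates. -/

theorem theta_eq {r : ℕ∞} {z : idx r → ℝ} (hz : coord _ 1 z ≠ 0) (τ : idx r → ℝ) :
    theta 0 z τ = -(coord _ 0 τ / coord _ 1 z) ∧
    theta 1 z τ = -(coord _ 1 τ / coord _ 1 z - coord _ 0 τ * coord _ 2 z / coord _ 1 z ^ 2) ∧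
    theta 2 z τ = -(coord _ 2 τ / coord _ 1 z - 2 * coord _ 1 τ * coord _ 2 z / coord _ 1 z ^ 2 +
      coord _ 0 τ * (2 * coord _ 2 z ^ 2 / coord _ 1 z ^ 3 - coord _ 3 z / coord _ 1 z ^ 2)) := by
  set F : PowerSeries ℝ := PowerSeries.mk (fun p => coord _ (p + 1) z / (p.factorial : ℝ)) with hF
  have hF0 : PowerSeries.constantCoeff F ≠ 0 := by simpa [hF] using hz
  have hm := PowerSeries.mul_inv_cancel F hF0
  have g0 := congrArg (PowerSeries.coeff 0) hm
  have g1 := congrArg (PowerSeries.coeff 1) hm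
  have g2 := congrArg (PowerSeries.coeff 2) hm
  simp only [PowerSeries.coeff_mul, Finset.Nat.antidiagonal_succ, Finset.Nat.antidiagonal_zero,
    Finset.sum_cons, Finset.map_singleton, Finset.sum_singleton, Finset.map_cons,
    Function.Embedding.prodMap, PowerSeries.coeff_one, hF, PowerSeries.coeff_mk] at g0 g1 g2
  norm_num [Nat.factorial] at g0 g1 g2
  rw [← hF] at g1 g2
  simp only [theta, LinearMap.coe_mk, AddHom.coe_mk, ← hF]
  simp only [PowerSeries.coeff_mul, Finset.Nat.antidiagonal_succ, Finset.Nat.antidiagonal_zero,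
    Finset.sum_cons, Finset.map_singleton, Finset.sum_singleton, Finset.map_cons,
    Function.Embedding.prodMap, PowerSeries.coeff_mk]
  norm_num [Nat.factorial]
  have e1 : PowerSeries.coeff 1 F⁻¹ = -(coord _ 2 z / coord _ 1 z ^ 2) := by
    apply mul_left_cancel₀ hz
    rw [eq_neg_of_add_eq_zero_left g1]
    field_simp
  have e2 : PowerSeries.coeff 2 F⁻¹ =
      coord _ 2 z ^ 2 / coord _ 1 z ^ 3 - coord _ 3 z / 2 / coord _ 1 z ^ 2 := by
    apply mul_left_cancel₀ hz
    rw [eq_neg_of_add_eq_zero_left g2, e1]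
    field_simp
    ring
  have e0 : PowerSeries.constantCoeff F = coord _ 1 z := by simp [hF]
  rw [e0, e1, e2]
  refine ⟨?_, ?_, ?_⟩
  · field_simp
  · field_simp
    ring
  · field_simp
    ring

theorem coord_sectionO {r : ℕ∞} (p : ℕ) (hp : p ≠ 1) (x : idx r → ℝ) :
    coord _ p (sectionO x) = Real.exp (coord _ 1 x) ^ p * coord _ p x := by
  by_cases h : p ∈ idx r
  · simp [coord_of_mem h, sectionO, hp]
  · simp [coord, h]

theorem coord_sectionO_one {r : ℕ∞} (hr : 2 ≤ r) (x : idx r → ℝ) :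
    coord _ 1 (sectionO x) = Real.exp (coord _ 1 x) := by
  simp [coord_of_mem (one_mem_idx hr), sectionO]

theorem coord_dSectionO {r : ℕ∞} (p : ℕ) (hp : p ≠ 1) (x v : idx r → ℝ) :
    coord _ p (dSectionO x v) =
      Real.exp (coord _ 1 x) ^ p * (coord _ p v + p * coord _ p x * coord _ 1 v) := by
  by_cases h : p ∈ idx r
  · simp [coord_of_mem h, dSectionO, hp, mul_add]
  · simp [coord, h]

theorem coord_dSectionO_one {r : ℕ∞} (hr : 2 ≤ r) (x v : idx r → ℝ) :
    coord _ 1 (dSectionO x v) = Real.exp (coord _ 1 x) * coord _ 1 v := by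
  simp [coord_of_mem (one_mem_idx hr), dSectionO]

theorem coord_sectionGL {r : ℕ∞} (p : ℕ) (hp : p ≠ 1) (x : idxGL r → ℝ) :
    coord _ p (sectionGL x) = coord _ p x := by
  by_cases h : p ∈ idx r
  · simp [coord_of_mem h, sectionGL, hp]
  · have h' : p ∉ idxGL r := fun h' => h h'.1
    simp [coord, h, h']

theorem coord_sectionGL_one {r : ℕ∞} (hr : 2 ≤ r) (x : idxGL r → ℝ) :
    coord _ 1 (sectionGL x) = 1 := by
  simp [coord_of_mem (one_mem_idx hr), sectionGL]

theorem coord_dSectionGL {r : ℕ∞} (p : ℕ) (v : idxGL r → ℝ) :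
    coord _ p (dSectionGL v) = coord _ p v := by
  by_cases h : p ∈ idx r
  · simp [coord_of_mem h, dSectionGL]
  · have h' : p ∉ idxGL r := fun h' => h h'.1
    simp [coord, h, h']

theorem coord_one_idxGL {r : ℕ∞} (v : idxGL r → ℝ) : coord (idxGL r) 1 v = 0 := by
  have h : 1 ∉ idxGL r := fun h => h.2 rfl
  simp [coord, h]

/-- `dSectionO` is the differential of `sectionO`. -/
theorem tangentMap_sectionO {r : ℕ∞} (x v : idx r → ℝ) :
    tangentMap sectionO x v = dSectionO x v := by
  funext p
  have e : HasDerivAt (fun t : ℝ => Real.exp (coord _ 1 (x + t • v)))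
      (Real.exp (coord _ 1 x) * coord _ 1 v) 0 := by
    have h : HasDerivAt (fun t : ℝ => coord _ 1 (x + t • v)) (coord _ 1 v) 0 := by
      simp only [map_add, map_smul, smul_eq_mul]
      simpa using ((hasDerivAt_id (0 : ℝ)).mul_const (coord _ 1 v)).const_add (coord _ 1 x)
    simpa using h.exp
  have hx : HasDerivAt (fun t : ℝ => (x + t • v) p) (v p) 0 := by
    simpa using ((hasDerivAt_id (0 : ℝ)).mul_const (v p)).const_add (x p)
  by_cases hp : (p : ℕ) = 1
  · simp only [tangentMap, sectionO, hp, if_true, dSectionO, LinearMap.pi_apply,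
      LinearMap.smul_apply, smul_eq_mul]
    exact e.deriv
  · simp only [tangentMap, sectionO, hp, if_false, dSectionO, LinearMap.pi_apply,
      LinearMap.smul_apply, smul_eq_mul]
    refine ((e.pow (p : ℕ)).mul hx).deriv.trans ?_
    simp only [zero_smul, add_zero, LinearMap.add_apply, LinearMap.smul_apply,
      LinearMap.proj_apply, smul_eq_mul, Pi.pow_apply]
    rcases Nat.eq_zero_or_pos (p : ℕ) with h0 | h0
    · simp [h0]
    · obtain ⟨n, hn⟩ := Nat.exists_eq_succ_of_ne_zero h0.ne'
      rw [hn]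
      simp only [Nat.succ_eq_add_one, Nat.add_sub_cancel, pow_succ]
      push_cast
      ring

/-- `dSectionGL` is the differential of `sectionGL`. -/
theorem tangentMap_sectionGL {r : ℕ∞} (x v : idxGL r → ℝ) :
    tangentMap sectionGL x v = dSectionGL v := by
  funext p
  by_cases hp : (p : ℕ) = 1
  · simp [tangentMap, sectionGL, hp, dSectionGL, lineDeriv, coord_one_idxGL]
  · simp only [tangentMap, sectionGL, hp, if_false, dSectionGL, LinearMap.pi_apply, lineDeriv,
      map_add, map_smul, smul_eq_mul]
    exact ((((hasDerivAt_id (0 : ℝ)).mul_const (coord _ (p : ℕ) v)).const_add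
      (coord _ (p : ℕ) x)).congr_deriv (one_mul _)).deriv

/-- In coordinates, `θ₀ ∧ θ₁ ∧ θ₂ = - dx₀ ∧ dx₁ ∧ dx₂`. -/
theorem gvlField_eq {r : ℕ∞} (hr : 2 ≤ r) (x : idx r → ℝ) :
    gvlField x = -wedge ![coord _ 0, coord _ 1, coord _ 2] := by
  have hz : coord _ 1 (sectionO x) ≠ 0 := by
    rw [coord_sectionO_one hr]
    exact Real.exp_ne_zero _
  ext v
  obtain ⟨a0, b0, c0⟩ := theta_eq hz (dSectionO x (v 0))
  obtain ⟨a1, b1, c1⟩ := theta_eq hz (dSectionO x (v 1))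
  obtain ⟨a2, b2, c2⟩ := theta_eq hz (dSectionO x (v 2))
  rw [gvlField, AlternatingMap.compLinearMap_apply, AlternatingMap.neg_apply, wedge_apply,
    wedge_apply, Matrix.det_fin_three, Matrix.det_fin_three]
  simp [a0, b0, c0, a1, b1, c1, a2, b2, c2, coord_sectionO, coord_sectionO_one hr,
    coord_dSectionO, coord_dSectionO_one hr]
  field_simp
  ring

/-- In coordinates, `θ₂ ∧ θ₀ = dx₂ ∧ dx₀`. -/
theorem clField_eq {r : ℕ∞} (hr : 2 ≤ r) (x : idxGL r → ℝ) :
    clField x = wedge ![coord _ 2, coord _ 0] := by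
  have hz : coord _ 1 (sectionGL x) ≠ 0 := by
    rw [coord_sectionGL_one hr]
    exact one_ne_zero
  ext v
  obtain ⟨a0, -, c0⟩ := theta_eq hz (dSectionGL (v 0))
  obtain ⟨a1, -, c1⟩ := theta_eq hz (dSectionGL (v 1))
  rw [clField, AlternatingMap.compLinearMap_apply, wedge_apply, wedge_apply, Matrix.det_fin_two, Matrix.det_fin_two]
  simp [a0, c0, a1, c1, coord_sectionGL, coord_sectionGL_one hr,
    coord_dSectionGL, coord_one_idxGL]
  ring

/-! The forms `θ₀ ∧ θ₁ ∧ θ₂` and `θ₂ ∧ θ₀` are preserved by the morphisms of charts and closed. -/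

theorem coord_toO {r : ℕ∞} (p : ℕ) (hp : p ≠ 1) (z : idx r → ℝ) :
    coord _ p (toO z) = coord _ p z / coord _ 1 z ^ p := by
  by_cases h : p ∈ idx r
  · simp [coord_of_mem h, toO, hp]
  · simp [coord, h]

theorem coord_toO_one {r : ℕ∞} (hr : 2 ≤ r) (z : idx r → ℝ) :
    coord _ 1 (toO z) = Real.log |coord _ 1 z| := by
  rw [coord_of_mem (one_mem_idx hr)]
  simp only [toO, if_true]

theorem coord_toGL {r : ℕ∞} (p : ℕ) (hp : p ≠ 1) (z : idx r → ℝ) :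
    coord _ p (toGL z) = coord _ p z / coord _ 1 z ^ p := by
  by_cases h : p ∈ idxGL r
  · rw [coord_of_mem h]
    rfl
  · have h' : p ∉ idx r := fun h' => h ⟨h', hp⟩
    simp [coord, h, h']

/-- `toO` maps the frames of `U` onto `{x | x₀ ∈ U}`. -/
theorem image_toO {r : ℕ∞} (hr : 2 ≤ r) (U : TopologicalSpace.Opens ℝ) :
    toO '' Frames r U = {x | coord _ 0 x ∈ U} := by
  ext x
  constructor
  · rintro ⟨z, hz, rfl⟩
    simpa [coord_toO 0 zero_ne_one] using hz.1
  · intro hx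
    refine ⟨sectionO x, ⟨?_, ?_⟩, toO_sectionO x⟩
    · simpa [coord_sectionO 0 zero_ne_one] using hx
    · simp [coord_sectionO_one hr]

/-- `toGL` maps the frames of `U` onto `{x | x₀ ∈ U}`. -/
theorem image_toGL {r : ℕ∞} (hr : 2 ≤ r) (U : TopologicalSpace.Opens ℝ) :
    toGL '' Frames r U = {x | coord _ 0 x ∈ U} := by
  ext x
  constructor
  · rintro ⟨z, hz, rfl⟩
    simpa [coord_toGL 0 zero_ne_one] using hz.1
  · intro hx
    refine ⟨sectionGL x, ⟨?_, ?_⟩, ?_⟩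
    · simpa [coord_sectionGL 0 zero_ne_one] using hx
    · simp [coord_sectionGL_one hr]
    · funext p
      simp only [toGL, coord_sectionGL_one hr, one_pow, div_one]
      rw [coord_sectionGL (p : ℕ) p.2.2, coord_of_mem p.2]

theorem coord_shift {r : ℕ∞} (n : ℤ) (p : ℕ) (hp : p ≠ 1) (x : idx r → ℝ) :
    coord _ p (shift n x) = coord _ p x := by
  by_cases h : p ∈ idx r
  · simp [coord_of_mem h, shift, hp]
  · simp [coord, h]

theorem coord_shift_one {r : ℕ∞} (hr : 2 ≤ r) (n : ℤ) (x : idx r → ℝ) :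
    coord _ 1 (shift n x) = coord _ 1 x + n := by
  simp [coord_of_mem (one_mem_idx hr), shift]

theorem coord_mapO_zero {r : ℕ∞} (m : ℝ → ℝ) (x : idx r → ℝ) :
    coord _ 0 (mapO m x) = m (coord _ 0 x) := by
  rw [mapO, coord_toO 0 zero_ne_one, coord_jetMap_zero, coord_sectionO 0 zero_ne_one]
  simp

theorem coord_mapGL_zero {r : ℕ∞} (m : ℝ → ℝ) (x : idxGL r → ℝ) :
    coord _ 0 (mapGL m x) = m (coord _ 0 x) := by
  rw [mapGL, coord_toGL 0 zero_ne_one, coord_jetMap_zero, coord_sectionGL 0 zero_ne_one]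
  simp

theorem IsEtale.differentiableAt {U V : TopologicalSpace.Opens ℝ} {m : ℝ → ℝ} (hm : IsEtale U V m)
    {x : ℝ} (hx : x ∈ U) : DifferentiableAt ℝ m x :=
  (hm.smooth.contDiffAt (U.isOpen.mem_nhds hx)).differentiableAt (by simp)

theorem coord_mapO_one {r : ℕ∞} (hr : 2 ≤ r) {U V : TopologicalSpace.Opens ℝ} {m : ℝ → ℝ}
    (hm : IsEtale U V m) {x : idx r → ℝ} (hx : coord _ 0 x ∈ U) :
    coord _ 1 (mapO m x) = Real.log (deriv m (coord _ 0 x)) + coord _ 1 x := by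
  have e : coord _ 0 (sectionO x) = coord _ 0 x := by simp [coord_sectionO 0 zero_ne_one]
  rw [mapO, coord_toO_one hr, coord_jetMap_one hr (by rw [e]; exact hm.differentiableAt hx), e,
    coord_sectionO_one hr, Real.log_abs, Real.log_mul (hm.regular _ hx) (Real.exp_ne_zero _),
    Real.log_exp]

theorem coord_mapO_two {r : ℕ∞} (hr : 2 ≤ r) {U V : TopologicalSpace.Opens ℝ} {m : ℝ → ℝ}
    (hm : IsEtale U V m) {x : idx r → ℝ} (hx : coord _ 0 x ∈ U) :
    coord _ 2 (mapO m x) = deriv (deriv m) (coord _ 0 x) / deriv m (coord _ 0 x) ^ 2 +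
      coord _ 2 x / deriv m (coord _ 0 x) := by
  have e : coord _ 0 (sectionO x) = coord _ 0 x := by simp [coord_sectionO 0 zero_ne_one]
  have h := hm.regular _ hx
  rw [mapO, coord_toO 2 (by norm_num), coord_jetMap_one hr (by rw [e]; exact hm.differentiableAt hx),
    coord_jetMap_two hr (by rw [e]; exact hx) hm.smooth, e, coord_sectionO_one hr,
    coord_sectionO 2 (by norm_num)]
  field_simp

theorem coord_mapGL_two {r : ℕ∞} (hr : 2 ≤ r) {U V : TopologicalSpace.Opens ℝ} {m : ℝ → ℝ}
    (hm : IsEtale U V m) {x : idxGL r → ℝ} (hx : coord _ 0 x ∈ U) :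
    coord _ 2 (mapGL m x) = deriv (deriv m) (coord _ 0 x) / deriv m (coord _ 0 x) ^ 2 +
      coord _ 2 x / deriv m (coord _ 0 x) := by
  have e : coord _ 0 (sectionGL x) = coord _ 0 x := by simp [coord_sectionGL 0 zero_ne_one]
  have h := hm.regular _ hx
  rw [mapGL, coord_toGL 2 (by norm_num),
    coord_jetMap_one hr (by rw [e]; exact hm.differentiableAt hx),
    coord_jetMap_two hr (by rw [e]; exact hx) hm.smooth, e, coord_sectionGL_one hr,
    coord_sectionGL 2 (by norm_num)]
  field_simp

theorem hasDerivAt_line {I : Set ℕ} (p : ℕ) (x v : I → ℝ) :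
    HasDerivAt (fun t : ℝ => coord I p (x + t • v)) (coord I p v) 0 := by
  simp only [map_add, map_smul, smul_eq_mul]
  simpa using ((hasDerivAt_id (0 : ℝ)).mul_const (coord I p v)).const_add (coord I p x)

theorem eventually_line {I : Set ℕ} {U : TopologicalSpace.Opens ℝ} {x : I → ℝ}
    (hx : coord I 0 x ∈ U) (v : I → ℝ) : ∀ᶠ t : ℝ in 𝓝 0, coord I 0 (x + t • v) ∈ U := by
  have hc : Continuous fun t : ℝ => coord I 0 (x + t • v) :=
    (continuous_coord I 0).comp (by fun_prop)
  exact hc.continuousAt.eventually_mem (by simpa using U.isOpen.mem_nhds hx)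

theorem hasDerivAt_second {I : Set ℕ} {U V : TopologicalSpace.Opens ℝ} {m : ℝ → ℝ}
    (hm : IsEtale U V m) {x : I → ℝ} (hx : coord I 0 x ∈ U) :
    ∃ C : ℝ, ∀ v : I → ℝ, HasDerivAt
      (fun t : ℝ => deriv (deriv m) (coord I 0 (x + t • v)) / deriv m (coord I 0 (x + t • v)) ^ 2 +
        coord I 2 (x + t • v) / deriv m (coord I 0 (x + t • v)))
      (coord I 2 v / deriv m (coord I 0 x) + C * coord I 0 v) 0 := by
  have h := hm.regular _ hx
  have hd : ContDiffOn ℝ ∞ (deriv m) U := hm.smooth.deriv_of_isOpen U.isOpen (by simp)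
  have hdd : ContDiffOn ℝ ∞ (deriv (deriv m)) U := hd.deriv_of_isOpen U.isOpen (by simp)
  have h1 := ((hd.contDiffAt (U.isOpen.mem_nhds hx)).differentiableAt (by simp)).hasDerivAt
  have h2 := ((hdd.contDiffAt (U.isOpen.mem_nhds hx)).differentiableAt (by simp)).hasDerivAt
  refine ⟨(deriv (deriv (deriv m)) (coord I 0 x) * deriv m (coord I 0 x) ^ 2 -
      deriv (deriv m) (coord I 0 x) * (2 * deriv m (coord I 0 x) * deriv (deriv m) (coord I 0 x))) /
      (deriv m (coord I 0 x) ^ 2) ^ 2 -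
      coord I 2 x * deriv (deriv m) (coord I 0 x) / deriv m (coord I 0 x) ^ 2, fun v => ?_⟩
  have e : coord I 0 (x + (0 : ℝ) • v) = coord I 0 x := by simp
  have e2 : coord I 2 (x + (0 : ℝ) • v) = coord I 2 x := by simp
  have g1 := HasDerivAt.comp (0 : ℝ) (h₂ := deriv m) (by rw [e]; exact h1) (hasDerivAt_line 0 x v)
  have g2 := HasDerivAt.comp (0 : ℝ) (h₂ := deriv (deriv m)) (by rw [e]; exact h2)
    (hasDerivAt_line 0 x v)
  have g := (g2.div (g1.pow 2) (by simpa [e] using h)).add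
    ((hasDerivAt_line 2 x v).div g1 (by simpa [e] using h))
  refine g.congr_deriv ?_
  simp only [Function.comp, Pi.pow_apply, e, e2]
  norm_num
  field_simp
  ring

theorem coord_tangent_zero {I J : Set ℕ} {U V : TopologicalSpace.Opens ℝ} {m : ℝ → ℝ}
    (hm : IsEtale U V m) {F : (I → ℝ) → (J → ℝ)} (hF : ∀ y, coord J 0 (F y) = m (coord I 0 y))
    {x : I → ℝ} (hx : coord I 0 x ∈ U) (v : I → ℝ) :
    coord J 0 (tangentMap F x v) = deriv m (coord I 0 x) * coord I 0 v := by
  rw [coord_tangentMap, lineDeriv]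
  simp only [hF]
  have e : coord I 0 (x + (0 : ℝ) • v) = coord I 0 x := by simp
  exact (HasDerivAt.comp (0 : ℝ) (h₂ := m) (by rw [e]; exact (hm.differentiableAt hx).hasDerivAt)
    (hasDerivAt_line 0 x v)).deriv

theorem coord_tangent_two {I J : Set ℕ} {U V : TopologicalSpace.Opens ℝ} {m : ℝ → ℝ}
    (hm : IsEtale U V m) {F : (I → ℝ) → (J → ℝ)}
    (hF : ∀ y, coord I 0 y ∈ U → coord J 2 (F y) =
      deriv (deriv m) (coord I 0 y) / deriv m (coord I 0 y) ^ 2 +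
        coord I 2 y / deriv m (coord I 0 y))
    {x : I → ℝ} (hx : coord I 0 x ∈ U) :
    ∃ C : ℝ, ∀ v, coord J 2 (tangentMap F x v) =
      coord I 2 v / deriv m (coord I 0 x) + C * coord I 0 v := by
  obtain ⟨C, hC⟩ := hasDerivAt_second hm hx
  refine ⟨C, fun v => ?_⟩
  rw [coord_tangentMap, lineDeriv, ← (hC v).deriv]
  refine Filter.EventuallyEq.deriv_eq ?_
  filter_upwards [eventually_line hx v] with t ht
  exact hF _ ht

theorem coord_tangent_one {I J : Set ℕ} {U V : TopologicalSpace.Opens ℝ} {m : ℝ → ℝ}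
    (hm : IsEtale U V m) {F : (I → ℝ) → (J → ℝ)} (n : ℝ)
    (hF : ∀ y, coord I 0 y ∈ U → coord J 1 (F y) =
      Real.log (deriv m (coord I 0 y)) + coord I 1 y + n)
    {x : I → ℝ} (hx : coord I 0 x ∈ U) (v : I → ℝ) :
    coord J 1 (tangentMap F x v) = coord I 1 v +
      deriv (deriv m) (coord I 0 x) / deriv m (coord I 0 x) * coord I 0 v := by
  have hd : ContDiffOn ℝ ∞ (deriv m) U := hm.smooth.deriv_of_isOpen U.isOpen (by simp)
  have h1 := ((hd.contDiffAt (U.isOpen.mem_nhds hx)).differentiableAt (by simp)).hasDerivAt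
  have e : coord I 0 (x + (0 : ℝ) • v) = coord I 0 x := by simp
  have g1 := HasDerivAt.comp (0 : ℝ) (h₂ := deriv m) (by rw [e]; exact h1) (hasDerivAt_line 0 x v)
  have g := ((g1.log (by simpa [e] using hm.regular _ hx)).add (hasDerivAt_line 1 x v)).add_const n
  rw [coord_tangentMap, lineDeriv]
  have hev : (fun t : ℝ => coord J 1 (F (x + t • v))) =ᶠ[𝓝 0] fun t =>
      Real.log (deriv m (coord I 0 (x + t • v))) + coord I 1 (x + t • v) + n := by
    filter_upwards [eventually_line hx v] with t ht
    exact hF _ ht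
  rw [hev.deriv_eq]
  refine g.deriv.trans ?_
  simp only [Function.comp, e]
  ring

/-- The form `θ₀ ∧ θ₁ ∧ θ₂` on `S''_r(X)/ℤ`. -/
def gvl {X : Type u} (D : D1Space X) (r : ℕ∞) : FormFamily (quotOZ D r) 3 :=
  fun c => ((quotOZ D r).dom c).indicator gvlField

/-- The form `θ₂ ∧ θ₀` on `S'_r(X)`. -/
def cl {X : Type u} (D : D1Space X) (r : ℕ∞) : FormFamily (quotGL D r) 2 :=
  fun c => ((quotGL D r).dom c).indicator clField

theorem gvl_mem {X : Type u} (D : D1Space X) {r : ℕ∞} (hr : 2 ≤ r) :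
    gvl D r ∈ Cocycles (quotOZ D r) 3 := by
  have hW : ∀ c, ∀ y ∈ (quotOZ D r).dom c,
      gvl D r c y = -wedge ![coord _ 0, coord _ 1, coord _ 2] := fun c y hy => by
    rw [gvl, Set.indicator_of_mem hy, gvlField_eq hr]
  refine ⟨⟨fun c => ?_, fun c x hx => Set.indicator_of_notMem hx _, ?_⟩,
    fun c x hx v => extD_const ((quotOZ D r).isOpen_dom c) (hW c) hx v⟩
  · refine isSmoothForm_const (-1)
      ![⟨0, zero_mem_idx r⟩, ⟨1, one_mem_idx hr⟩, ⟨2, two_mem_idx hr⟩] fun y hy => ?_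
    have e : (fun j => LinearMap.proj ((![⟨0, zero_mem_idx r⟩, ⟨1, one_mem_idx hr⟩,
        ⟨2, two_mem_idx hr⟩] : Fin 3 → idx r) j) : Fin 3 → (idx r → ℝ) →ₗ[ℝ] ℝ) =
        ![coord _ 0, coord _ 1, coord _ 2] := by
      funext j
      fin_cases j <;> simp [coord, zero_mem_idx, one_mem_idx hr, two_mem_idx hr]
    rw [hW c y hy, e]
    ext v
    simp
  · rintro c c' F ⟨m, hm, n, rfl⟩ x hx v
    have hx' : coord _ 0 x ∈ c.1.dom := hx
    have h0 : ∀ y, coord (idx r) 0 (shift n (mapO m y)) = m (coord (idx r) 0 y) := fun y => by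
      rw [coord_shift n 0 zero_ne_one, coord_mapO_zero]
    have h1 : ∀ y, coord (idx r) 0 y ∈ c.1.dom → coord (idx r) 1 (shift n (mapO m y)) =
        Real.log (deriv m (coord (idx r) 0 y)) + coord (idx r) 1 y + n := fun y hy => by
      rw [coord_shift_one hr, coord_mapO_one hr hm.etale hy]
    have h2 : ∀ y, coord (idx r) 0 y ∈ c.1.dom → coord (idx r) 2 (shift n (mapO m y)) =
        deriv (deriv m) (coord (idx r) 0 y) / deriv m (coord (idx r) 0 y) ^ 2 +
          coord (idx r) 2 y / deriv m (coord (idx r) 0 y) := fun y hy => by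
      rw [coord_shift n 2 (by norm_num), coord_mapO_two hr hm.etale hy]
    have hy : shift n (mapO m x) ∈ (quotOZ D r).dom c' := by
      change coord _ 0 _ ∈ c'.1.dom
      rw [h0]
      exact hm.etale.mapsTo _ hx'
    obtain ⟨C, hC⟩ := coord_tangent_two hm.etale h2 hx'
    have hA := hm.etale.regular _ hx'
    rw [pullbackForm, hW c' _ hy, hW c x hx, AlternatingMap.neg_apply, AlternatingMap.neg_apply,
      wedge_apply, wedge_apply, Matrix.det_fin_three, Matrix.det_fin_three]
    simp [coord_tangent_zero hm.etale h0 hx', coord_tangent_one hm.etale n h1 hx', hC]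
    field_simp
    ring

theorem cl_mem {X : Type u} (D : D1Space X) {r : ℕ∞} (hr : 2 ≤ r) :
    cl D r ∈ Cocycles (quotGL D r) 2 := by
  have hW : ∀ c, ∀ y ∈ (quotGL D r).dom c,
      cl D r c y = wedge ![coord _ 2, coord _ 0] := fun c y hy => by
    rw [cl, Set.indicator_of_mem hy, clField_eq hr]
  refine ⟨⟨fun c => ?_, fun c x hx => Set.indicator_of_notMem hx _, ?_⟩,
    fun c x hx v => extD_const ((quotGL D r).isOpen_dom c) (hW c) hx v⟩
  · refine isSmoothForm_const 1
      ![⟨2, two_mem_idxGL hr⟩, ⟨0, zero_mem_idxGL r⟩] fun y hy => ?_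
    rw [hW c y hy, one_smul]
    congr 1
    funext j
    ext w
    fin_cases j <;> simp [coord, zero_mem_idxGL, two_mem_idxGL hr]
  · rintro c c' F ⟨m, hm, rfl⟩ x hx v
    have hx' : coord _ 0 x ∈ c.1.dom := hx
    have h0 := coord_mapGL_zero (r := r) m
    have hy : mapGL m x ∈ (quotGL D r).dom c' := by
      change coord _ 0 _ ∈ c'.1.dom
      rw [h0]
      exact hm.etale.mapsTo _ hx'
    obtain ⟨C, hC⟩ := coord_tangent_two hm.etale
      (fun y hy => coord_mapGL_two hr hm.etale hy) hx'
    have hA := hm.etale.regular _ hx'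
    rw [pullbackForm, hW c' _ hy, hW c x hx, wedge_apply, wedge_apply, Matrix.det_fin_two,
      Matrix.det_fin_two]
    simp [coord_tangent_zero hm.etale h0 hx', hC]
    field_simp
    ring

/-- The Godbillon–Vey–Losik class of `X` in `H³(S''_r(X)/ℤ)`. -/
def GVL {X : Type u} (D : D1Space X) (r : ℕ∞) (hr : 2 ≤ r) : Cohomology (quotOZ D r) 3 :=
  Cohomology.mk _ ⟨gvl D r, gvl_mem D hr⟩

/-- The first Chern–Losik class of `X` in `H²(S'_r(X))`. -/
def CL₁ {X : Type u} (D : D1Space X) (r : ℕ∞) (hr : 2 ≤ r) : Cohomology (quotGL D r) 2 :=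
  Cohomology.mk _ ⟨cl D r, cl_mem D hr⟩

end Losik

end

/-! Forgetting `x₁` gives a projection `S''(U) → S'(U)` with fibre `ℝ`. After division by the action
`x₁ ↦ x₁ + n` of `ℤ` the fibre is a circle of length one, so forms can be integrated over the
compact fibre. This fibre integration sends two-forms on `S''(X)/ℤ` to one-forms on `S'(X)`. It
anticommutes with `d`, since the boundary terms at `x₁ = 0` and `x₁ = 1` cancel
(`extD_fiberIntegral`). Contraction of `-dx₀ ∧ dx₁ ∧ dx₂` with `∂/∂x₁` gives `dx₀ ∧ dx₂ = -dx₂ ∧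
dx₀`, so the GVL form contracts to minus the CL form, and this is constant along the fibres
(`gvl_fiberPoint`). Hence if the GVL form is `dβ`, the fibre integral of `β` is a primitive of the
CL form.

Two points need care. The fibre integral must be compatible with the morphisms of charts
(`fiberIntegralFamily_mem`): an étale map `m` translates the fibre by `ln |m'(x₀)|`, which does not
change the integral of a periodic function, and it changes a lift of a tangent vector only by a
multiple of `∂/∂x₁`, which the contracted form kills. The fibre integral must also be smooth in the
sense of finitely many coordinates when `r = ∞`: compactness of `[0, 1]` makes the local finiteness
uniform along a fibre (`IsSmoothForm.exists_finset_fiberIntegrand`), and then differentiation under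
the integral sign applies in finite dimension. Nothing depends on `r` beyond `r ≥ 2`, so both claims
have the same proof. -/

noncomputable section

namespace Losik

/-! ### Integrals over the unit interval depending on a parameter -/

section Parametric

variable {E F : Type} [NormedAddCommGroup E] [NormedAddCommGroup F]

theorem intervalIntegrable_slice {B : E × ℝ → F}
    {Ω : Set (E × ℝ)} (hB : ContinuousOn B Ω) {q : E}
    (hq : ∀ t ∈ Set.Icc (0 : ℝ) 1, (q, t) ∈ Ω) :
    IntervalIntegrable (fun t => B (q, t)) MeasureTheory.volume 0 1 := by
  refine ContinuousOn.intervalIntegrable ?_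
  rw [Set.uIcc_of_le zero_le_one]
  exact hB.comp (by fun_prop) hq

/-- The tube lemma for the compact interval `[0, 1]`. -/
theorem eventually_slice_mem {Ω : Set (E × ℝ)} (hΩ : IsOpen Ω) {q : E}
    (hq : ∀ t ∈ Set.Icc (0 : ℝ) 1, (q, t) ∈ Ω) :
    ∀ᶠ x in 𝓝 q, ∀ t ∈ Set.Icc (0 : ℝ) 1, (x, t) ∈ Ω :=
  isCompact_Icc.eventually_forall_of_forall_eventually (P := fun x t => (x, t) ∈ Ω)
    fun t ht => hΩ.mem_nhds (hq t ht)

variable [NormedSpace ℝ E] [NormedSpace ℝ F]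

theorem hasFDerivAt_slice {B : E × ℝ → F} {Ω : Set (E × ℝ)} (hΩ : IsOpen Ω)
    (hB : ContDiffOn ℝ ∞ B Ω) {q : E} {t : ℝ} (h : (q, t) ∈ Ω) :
    HasFDerivAt (fun x => B (x, t)) ((fderiv ℝ B (q, t)).comp (.inl ℝ E ℝ)) q :=
  ((hB.contDiffAt (hΩ.mem_nhds h)).differentiableAt (by simp)).hasFDerivAt.comp q
    (hasFDerivAt_prodMk_left q t)

theorem contDiffOn_fderiv_inl {B : E × ℝ → F} {Ω : Set (E × ℝ)} (hΩ : IsOpen Ω)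
    (hB : ContDiffOn ℝ ∞ B Ω) :
    ContDiffOn ℝ ∞ (fun z => (fderiv ℝ B z).comp (.inl ℝ E ℝ)) Ω :=
  (hB.fderiv_of_isOpen hΩ (by simp)).clm_comp contDiffOn_const

/-- Dominated differentiation under the integral sign. A constant dominates: the partial derivative
is bounded on the compact slice over `q`, hence on all nearby slices with a slightly larger bound.
-/
theorem hasFDerivAt_integral_slice {B : E × ℝ → F} {Ω : Set (E × ℝ)} (hΩ : IsOpen Ω)
    (hB : ContDiffOn ℝ ∞ B Ω) {q : E} (hq : ∀ t ∈ Set.Icc (0 : ℝ) 1, (q, t) ∈ Ω) :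
    HasFDerivAt (fun x => ∫ t in (0 : ℝ)..1, B (x, t))
      (∫ t in (0 : ℝ)..1, (fderiv ℝ B (q, t)).comp (.inl ℝ E ℝ)) q := by
  have hD := (contDiffOn_fderiv_inl hΩ hB).continuousOn
  have hsub : Set.uIoc (0 : ℝ) 1 ⊆ Set.Icc 0 1 := by
    rw [Set.uIoc_of_le zero_le_one]
    exact Set.Ioc_subset_Icc_self
  obtain ⟨C, hC⟩ := isCompact_Icc.exists_bound_of_continuousOn
    (f := fun t : ℝ => (fderiv ℝ B (q, t)).comp (.inl ℝ E ℝ)) (hD.comp (by fun_prop) hq)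
  -- The slack `C + 1` turns the bound `≤ C` over `q` into a strict, hence open, condition, which
  -- spreads to nearby slices by compactness.
  have hbd : ∀ᶠ x in 𝓝 q, ∀ t ∈ Set.Icc (0 : ℝ) 1,
      ‖(fderiv ℝ B (x, t)).comp (.inl ℝ E ℝ)‖ < C + 1 := by
    refine isCompact_Icc.eventually_forall_of_forall_eventually
      (P := fun x t => ‖(fderiv ℝ B (x, t)).comp (.inl ℝ E ℝ)‖ < C + 1) fun t ht => ?_
    exact (hD.continuousAt (hΩ.mem_nhds (hq t ht))).norm.eventually_lt_const
      ((hC t ht).trans_lt (lt_add_one C))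
  have hmem := eventually_slice_mem hΩ hq
  refine intervalIntegral.hasFDerivAt_integral_of_dominated_of_fderiv_le
    (F := fun x t => B (x, t)) (F' := fun x t => (fderiv ℝ B (x, t)).comp (.inl ℝ E ℝ))
    (bound := fun _ => C + 1) (hmem.and hbd) ?_ ?_ ?_ ?_ (by simp) ?_
  · filter_upwards [hmem] with x hx
    exact (intervalIntegrable_slice hB.continuousOn hx).def'.aestronglyMeasurable
  · exact intervalIntegrable_slice hB.continuousOn hq
  · exact (intervalIntegrable_slice hD hq).def'.aestronglyMeasurable
  · exact Filter.Eventually.of_forall fun t ht x hx => (hx.2 t (hsub ht)).le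
  · exact Filter.Eventually.of_forall fun t ht x hx =>
      hasFDerivAt_slice hΩ hB (hx.1 t (hsub ht))

/-- Induction on the order of differentiability: the derivative of the integral is again such an
integral, but with values in `E →L[ℝ] F`. For this reason `F` and `B` are quantified after `n`,
inside the induction. -/
theorem contDiffOn_nat_integral_slice (n : ℕ) {Ω : Set (E × ℝ)} (hΩ : IsOpen Ω) {V : Set E}
    (hV : IsOpen V) (hVΩ : ∀ q ∈ V, ∀ t ∈ Set.Icc (0 : ℝ) 1, (q, t) ∈ Ω) :
    ∀ {F : Type} [NormedAddCommGroup F] [NormedSpace ℝ F] {B : E × ℝ → F},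
      ContDiffOn ℝ ∞ B Ω → ContDiffOn ℝ n (fun x => ∫ t in (0 : ℝ)..1, B (x, t)) V := by
  induction n with
  | zero =>
    intro F _ _ B hB
    rw [Nat.cast_zero, contDiffOn_zero]
    exact fun q hq =>
      (hasFDerivAt_integral_slice hΩ hB (hVΩ q hq)).continuousAt.continuousWithinAt
  | succ n ih =>
    intro F _ _ B hB
    rw [Nat.cast_succ, contDiffOn_succ_iff_fderiv_of_isOpen hV]
    refine ⟨fun q hq => (hasFDerivAt_integral_slice hΩ hB
      (hVΩ q hq)).differentiableAt.differentiableWithinAt, by simp, ?_⟩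
    exact (ih (contDiffOn_fderiv_inl hΩ hB)).congr fun q hq =>
      (hasFDerivAt_integral_slice hΩ hB (hVΩ q hq)).fderiv

theorem contDiffOn_integral_slice {Ω : Set (E × ℝ)} (hΩ : IsOpen Ω) {V : Set E}
    (hV : IsOpen V) (hVΩ : ∀ q ∈ V, ∀ t ∈ Set.Icc (0 : ℝ) 1, (q, t) ∈ Ω) {B : E × ℝ → F}
    (hB : ContDiffOn ℝ ∞ B Ω) :
    ContDiffOn ℝ ∞ (fun x => ∫ t in (0 : ℝ)..1, B (x, t)) V :=
  contDiffOn_infty.2 fun n => contDiffOn_nat_integral_slice n hΩ hV hVΩ hB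

/-- The one-parameter case, for directional derivatives of the fibre integral. Integrability of the
derivative is recorded because the integral of `extD` is later split into its summands. -/
theorem hasDerivAt_integral_slice {B : ℝ × ℝ → ℝ} {Ω : Set (ℝ × ℝ)} (hΩ : IsOpen Ω)
    (hB : ContDiffOn ℝ ∞ B Ω) {q : ℝ} (hq : ∀ t ∈ Set.Icc (0 : ℝ) 1, (q, t) ∈ Ω) :
    IntervalIntegrable (fun t => deriv (fun x => B (x, t)) q) MeasureTheory.volume 0 1 ∧
    HasDerivAt (fun x => ∫ t in (0 : ℝ)..1, B (x, t))
      (∫ t in (0 : ℝ)..1, deriv (fun x => B (x, t)) q) q := by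
  have hD := (contDiffOn_fderiv_inl hΩ hB).continuousOn
  have hi := intervalIntegrable_slice hD hq
  have e : ∀ t ∈ Set.Icc (0 : ℝ) 1, ((fderiv ℝ B (q, t)).comp (.inl ℝ ℝ ℝ)) 1 =
      deriv (fun x => B (x, t)) q := fun t ht =>
    (hasFDerivAt_slice hΩ hB (hq t ht)).hasDerivAt.deriv.symm
  constructor
  · refine IntervalIntegrable.congr (f := fun t => ((fderiv ℝ B (q, t)).comp (.inl ℝ ℝ ℝ)) 1)
      (fun t ht => e t ?_)
      (intervalIntegrable_slice (B := fun z => ((fderiv ℝ B z).comp (.inl ℝ ℝ ℝ)) 1)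
        (hD.clm_apply continuousOn_const) hq)
    rw [Set.uIoc_of_le zero_le_one] at ht
    exact Set.Ioc_subset_Icc_self ht
  · refine (hasFDerivAt_integral_slice hΩ hB hq).hasDerivAt.congr_deriv ?_
    rw [ContinuousLinearMap.intervalIntegral_apply hi]
    refine intervalIntegral.integral_congr fun t ht => e t ?_
    rwa [Set.uIcc_of_le zero_le_one] at ht

end Parametric

/-- A smooth form is smooth along smooth maps from normed spaces. -/
theorem IsSmoothForm.contDiffOn_comp {ι E : Type} [NormedAddCommGroup E] [NormedSpace ℝ E] {k : ℕ}
    {W : Set (ι → ℝ)} (hW : IsOpen W) {φ : FormField ι k} (hφ : IsSmoothForm W φ)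
    {A : E → ι → ℝ} (hA : ∀ i, ContDiff ℝ ∞ fun e => A e i) (w : Fin k → ι → ℝ) :
    ContDiffOn ℝ ∞ (fun e => φ (A e) w) (A ⁻¹' W) := by
  intro e he
  obtain ⟨s, V, η, hV, hxV, hη, h⟩ := hφ _ he
  have hc : Continuous A := continuous_pi fun i => (hA i).continuous
  have hp : ContDiff ℝ ∞ fun e => proj s (A e) := contDiff_pi.2 fun i => hA i
  refine ContDiffAt.contDiffWithinAt ?_
  refine ContDiffAt.congr_of_eventuallyEq (f := fun e => η (proj s (A e)) fun i => proj s (w i))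
    (ContDiffAt.comp e (g := fun y => η y fun i => proj s (w i))
      ((hη _).contDiffAt (hV.mem_nhds hxV)) hp.contDiffAt) ?_
  filter_upwards [(hW.preimage hc).mem_nhds he, (hV.preimage hp.continuous).mem_nhds hxV]
    with z h1 h2
  rw [h _ h1 h2]
  rfl

/-! ### The projection `S''(U) → S'(U)` in coordinates -/

variable {r : ℕ∞}

/-- The coordinate vector field `∂/∂x₁` on `S''(U)`. -/
def vertical : idx r → ℝ := fun p => if (p : ℕ) = 1 then 1 else 0

/-- The point of `S''(U)` over `y ∈ S'(U)` with `x₁ = t`. -/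
def fiberPoint (y : idxGL r → ℝ) (t : ℝ) : idx r → ℝ := dSectionGL y + t • vertical

theorem fiberPoint_apply (y : idxGL r → ℝ) (t : ℝ) (p : idx r) :
    fiberPoint y t p = if (p : ℕ) = 1 then t else coord _ (p : ℕ) y := by
  by_cases hp : (p : ℕ) = 1 <;>
    simp [fiberPoint, dSectionGL, vertical, hp, coord_one_idxGL]

theorem coord_vertical {p : ℕ} (hp : p ≠ 1) : coord (idx r) p vertical = 0 := by
  by_cases h : p ∈ idx r
  · simp [coord_of_mem h, vertical, hp]
  · simp [coord, h]

theorem coord_vertical_one (hr : 2 ≤ r) : coord (idx r) 1 vertical = 1 := by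
  simp [coord_of_mem (one_mem_idx hr), vertical]

theorem coord_fiberPoint {p : ℕ} (hp : p ≠ 1) (y : idxGL r → ℝ) (t : ℝ) :
    coord _ p (fiberPoint y t) = coord _ p y := by
  simp [fiberPoint, coord_vertical hp, coord_dSectionGL]

theorem coord_fiberPoint_one (hr : 2 ≤ r) (y : idxGL r → ℝ) (t : ℝ) :
    coord _ 1 (fiberPoint y t) = t := by
  simp [fiberPoint, coord_vertical_one hr, coord_dSectionGL, coord_one_idxGL]

theorem shift_fiberPoint (n : ℤ) (y : idxGL r → ℝ) (t : ℝ) :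
    shift n (fiberPoint y t) = fiberPoint y (t + n) := by
  funext p
  simp only [shift, fiberPoint_apply]
  split_ifs <;> rfl

/-- Moving along the fibre is the action of `e^t ∈ GL(1)` on the frame with `z₁ = 1`. As `jetMap`
commutes with this action, the induced maps can be compared fibrewise. -/
theorem sectionO_fiberPoint (hr : 2 ≤ r) (y : idxGL r → ℝ) (t : ℝ) :
    sectionO (fiberPoint y t) = scale (Real.exp t) (sectionGL y) := by
  funext p
  simp only [sectionO, coord_fiberPoint_one hr, scale, sectionGL, fiberPoint_apply]
  split_ifs with hp <;> simp [hp]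

theorem ext_coord {x y : idx r → ℝ} (h : ∀ p, coord _ p x = coord _ p y) : x = y := by
  funext p
  simpa [coord_of_mem p.2] using h p

/-- The map `S''(m)` covers `S'(m)` off the coordinate `x₁`. -/
theorem coord_mapO (hr : 2 ≤ r) (m : ℝ → ℝ) {p : ℕ} (hp : p ≠ 1) (y : idxGL r → ℝ) (t : ℝ) :
    coord _ p (mapO m (fiberPoint y t)) = coord _ p (mapGL m y) := by
  -- The factor `(e^t)^p` occurs in both `z_p` and `z₁^p` and cancels, so that `t` disappears.
  rw [mapO, sectionO_fiberPoint hr, jetMap_scale, coord_toO p hp, coord_scale, coord_scale,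
    pow_one, mul_pow, mul_div_mul_left _ _ (pow_ne_zero _ (Real.exp_ne_zero _)), mapGL,
    coord_toGL p hp]

/-- On each fibre an étale map acts as a translation, by an amount depending only on `x₀`.
`Real.log` is the logarithm of the absolute value, so a negative derivative is allowed. -/
theorem mapO_fiberPoint (hr : 2 ≤ r) {U V : TopologicalSpace.Opens ℝ} {m : ℝ → ℝ}
    (hm : IsEtale U V m) {y : idxGL r → ℝ} (hy : coord _ 0 y ∈ U) (t : ℝ) :
    mapO m (fiberPoint y t) =
      fiberPoint (mapGL m y) (t + Real.log (deriv m (coord _ 0 y))) := by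
  refine ext_coord fun p => ?_
  by_cases hp : p = 1
  · subst hp
    rw [coord_mapO_one hr hm (by rwa [coord_fiberPoint zero_ne_one]), coord_fiberPoint_one hr,
      coord_fiberPoint_one hr, coord_fiberPoint zero_ne_one, add_comm]
  · rw [coord_mapO hr m hp, coord_fiberPoint hp]

theorem fiberPoint_add_smul (y w : idxGL r → ℝ) (t s : ℝ) :
    fiberPoint y t + s • dSectionGL w = fiberPoint (y + s • w) t := by
  simp only [fiberPoint, map_add, map_smul]
  abel

theorem fiberPoint_add_smul_vertical (y : idxGL r → ℝ) (t s : ℝ) :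
    fiberPoint y t + s • vertical = fiberPoint y (t + s) := by
  simp only [fiberPoint, add_smul]
  abel

theorem tangentMap_mapO_vertical (hr : 2 ≤ r) {U V : TopologicalSpace.Opens ℝ} {m : ℝ → ℝ}
    (hm : IsEtale U V m) {y : idxGL r → ℝ} (hy : coord _ 0 y ∈ U) (t : ℝ) :
    tangentMap (mapO m) (fiberPoint y t) vertical = vertical := by
  refine ext_coord fun p => ?_
  rw [coord_tangentMap, lineDeriv]
  simp only [fiberPoint_add_smul_vertical]
  by_cases hp : p = 1
  · subst hp
    simp only [mapO_fiberPoint hr hm hy, coord_fiberPoint_one hr, coord_vertical_one hr]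
    exact ((((hasDerivAt_id (0 : ℝ)).const_add t).add_const _)).deriv
  · simp [coord_mapO hr m hp, coord_vertical hp]

/-- The lift with zero `x₁`-component is not preserved by morphisms, as the translation of the fibre
varies with `x₀`. The error is vertical. Its size `a` is irrelevant, because it is only ever paired
with `vertical` itself. -/
theorem tangentMap_mapO_dSectionGL (hr : 2 ≤ r) (m : ℝ → ℝ) (y : idxGL r → ℝ) (t : ℝ)
    (w : idxGL r → ℝ) :
    ∃ a : ℝ, tangentMap (mapO m) (fiberPoint y t) (dSectionGL w) =
      dSectionGL (tangentMap (mapGL m) y w) + a • vertical := by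
  refine ⟨coord _ 1 (tangentMap (mapO m) (fiberPoint y t) (dSectionGL w)),
    ext_coord fun p => ?_⟩
  by_cases hp : p = 1
  · subst hp
    simp [coord_dSectionGL, coord_one_idxGL, coord_vertical_one hr]
  · rw [coord_tangentMap, lineDeriv, map_add, map_smul, coord_vertical hp, coord_dSectionGL,
      coord_tangentMap, lineDeriv]
    simp only [fiberPoint_add_smul, coord_mapO hr m hp, smul_zero, add_zero]

/-- Only the term `t^p` of the Taylor polynomial contributes to its `p`-th derivative at `0`. This
serves to exhibit `shift n` alone as a morphism of `quotOZ`, lying over the identity of a chart. -/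
theorem jetMap_id (z : idx r → ℝ) : jetMap (fun x => x) z = z := by
  funext p
  simp only [jetMap]
  rw [iteratedDeriv_fun_sum fun j _ => by fun_prop]
  simp only [iteratedDeriv_const_mul_field, iteratedDeriv_fun_pow_zero]
  rw [Finset.sum_eq_single (p : ℕ)]
  · rw [if_pos rfl, div_mul_cancel₀ _ (by positivity), coord_of_mem p.2]
  · intro j _ hj
    simp [hj.symm]
  · simp

theorem mapO_id (x : idx r → ℝ) : mapO (fun x => x) x = x := by
  rw [mapO, jetMap_id, toO_sectionO]

theorem isChartMorphism_id {X : Type*} (c : Chart X) : IsChartMorphism c c fun x => x :=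
  ⟨⟨fun _ hx => hx, contDiffOn_id, fun _ _ => by simp⟩, fun _ => rfl⟩

/-! ### Integration over the fibres of `S''(U)/ℤ → S'(U)` -/

theorem contDiff_fiberPoint {E : Type} [NormedAddCommGroup E] [NormedSpace ℝ E]
    {a : E → idxGL r → ℝ} {b : E → ℝ} (ha : ∀ i, ContDiff ℝ ∞ fun e => a e i)
    (hb : ContDiff ℝ ∞ b) (p : idx r) : ContDiff ℝ ∞ fun e => fiberPoint (a e) (b e) p := by
  simp only [fiberPoint_apply]
  split_ifs with hp
  · exact hb
  · simp only [coord_of_mem (show (p : ℕ) ∈ idxGL r from ⟨p.2, hp⟩)]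
    exact ha _

theorem isOpen_preimage_coord (I : Set ℕ) (U : TopologicalSpace.Opens ℝ) :
    IsOpen {x : I → ℝ | coord I 0 x ∈ U} :=
  U.isOpen.preimage (continuous_coord I 0)

/-- The function on the fibre over `y` that is integrated to obtain the value on `w` of the fibre
integral of `φ`. -/
def fiberIntegrand (φ : FormField (idx r) 2) (y w : idxGL r → ℝ) (t : ℝ) : ℝ :=
  φ (fiberPoint y t) ![vertical, dSectionGL w]

theorem _root_.AlternatingMap.map_pair_add {M : Type} [AddCommGroup M] [Module ℝ M]
    (f : M [⋀^Fin 2]→ₗ[ℝ] ℝ) (a b c : M) : f ![a, b + c] = f ![a, b] + f ![a, c] := by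
  have e : ∀ x, Function.update ![a, b] 1 x = ![a, x] := fun x => by
    funext i
    fin_cases i <;> rfl
  simpa only [e] using f.map_update_add ![a, b] 1 b c

theorem _root_.AlternatingMap.map_pair_smul {M : Type} [AddCommGroup M] [Module ℝ M]
    (f : M [⋀^Fin 2]→ₗ[ℝ] ℝ) (a b : M) (s : ℝ) : f ![a, s • b] = s * f ![a, b] := by
  have e : ∀ x, Function.update ![a, b] 1 x = ![a, x] := fun x => by
    funext i
    fin_cases i <;> rfl
  simpa only [e, smul_eq_mul] using f.map_update_smul ![a, b] 1 s b

/-- The integral of a two-form over the fibres `0 ≤ x₁ ≤ 1`. -/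
def fiberIntegral (φ : FormField (idx r) 2) (hφ : ∀ y w, Continuous (fiberIntegrand φ y w)) :
    FormField (idxGL r) 1 := fun y =>
  AlternatingMap.ofSubsingleton ℝ _ ℝ 0
    { toFun := fun w => ∫ t in (0 : ℝ)..1, fiberIntegrand φ y w t
      map_add' := fun w w' => by
        rw [← intervalIntegral.integral_add ((hφ y w).intervalIntegrable _ _)
          ((hφ y w').intervalIntegrable _ _)]
        simp only [fiberIntegrand, map_add, AlternatingMap.map_pair_add]
      map_smul' := fun a w => by
        simp only [fiberIntegrand, map_smul, AlternatingMap.map_pair_smul, RingHom.id_apply,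
          smul_eq_mul, intervalIntegral.integral_const_mul] }

theorem fiberIntegral_apply (φ : FormField (idx r) 2)
    (hφ : ∀ y w, Continuous (fiberIntegrand φ y w)) (y : idxGL r → ℝ)
    (v : Fin 1 → idxGL r → ℝ) :
    fiberIntegral φ hφ y v = ∫ t in (0 : ℝ)..1, fiberIntegrand φ y (v 0) t := rfl

/-- Joint smoothness in the parameter and in `x₁`. The family `a` is a line in `S'(U)` for
directional derivatives, and a finite set of varying coordinates for smoothness of the fibre
integral. -/
theorem IsSmoothForm.contDiffOn_fiberIntegrand {U : TopologicalSpace.Opens ℝ}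
    {φ : FormField (idx r) 2} (hφ : IsSmoothForm {x | coord _ 0 x ∈ U} φ) {E : Type}
    [NormedAddCommGroup E] [NormedSpace ℝ E] {a : E → idxGL r → ℝ}
    (ha : ∀ i, ContDiff ℝ ∞ fun e => a e i) (w : idxGL r → ℝ) :
    ContDiffOn ℝ ∞ (fun z : E × ℝ => fiberIntegrand φ (a z.1) w z.2)
      {z | coord _ 0 (a z.1) ∈ U} := by
  have h := hφ.contDiffOn_comp (isOpen_preimage_coord _ U)
    (contDiff_fiberPoint (E := E × ℝ) (a := fun z => a z.1) (fun i => (ha i).comp contDiff_fst)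
      contDiff_snd)
    ![vertical, dSectionGL w]
  simp only [Set.preimage_ofPred_eq, coord_fiberPoint zero_ne_one] at h
  exact h

/-- The normalization of forms by `0` off the domain gives continuity for every `y`, as the
definition of `fiberIntegral` demands for additivity. -/
theorem IsSmoothForm.continuous_fiberIntegrand {U : TopologicalSpace.Opens ℝ}
    {φ : FormField (idx r) 2} (hφ : IsSmoothForm {x | coord _ 0 x ∈ U} φ)
    (h0 : ∀ x, coord _ 0 x ∉ U → φ x = 0) (y w : idxGL r → ℝ) :
    Continuous (fiberIntegrand φ y w) := by
  by_cases hy : coord _ 0 y ∈ U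
  -- The parameter space `ℝ` is a dummy here: the family is constant.
  · have h := (hφ.contDiffOn_fiberIntegrand (E := ℝ) (a := fun _ => y)
      (fun i => contDiff_const) w).continuousOn
    exact (h.comp_continuous (f := fun t : ℝ => ((0 : ℝ), t)) (by fun_prop) fun _ => hy)
  · have e : fiberIntegrand φ y w = fun _ => 0 := by
      funext t
      rw [fiberIntegrand, h0 _ (by rwa [coord_fiberPoint zero_ne_one]), AlternatingMap.zero_apply]
    rw [e]
    exact continuous_const

/-! ### Smoothness of the fibre integral by reduction to finitely many coordinates -/

/-- The point with coordinates `q` in `s` and the coordinates of `y` outside `s`. -/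
def extendBy {ι : Type} (y : ι → ℝ) (s : Finset ι) (q : s → ℝ) : ι → ℝ :=
  open Classical in fun i => if h : i ∈ s then q ⟨i, h⟩ else y i

theorem proj_extendBy {ι : Type} (y : ι → ℝ) (s : Finset ι) (q : s → ℝ) :
    proj s (extendBy y s q) = q := by
  funext i
  simp [proj, LinearMap.funLeft_apply, extendBy]

theorem extendBy_proj {ι : Type} (y : ι → ℝ) (s : Finset ι) : extendBy y s (proj s y) = y := by
  funext i
  simp [proj, LinearMap.funLeft_apply, extendBy]

theorem contDiff_extendBy {ι : Type} (y : ι → ℝ) (s : Finset ι) (i : ι) :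
    ContDiff ℝ ∞ fun q => extendBy y s q i := by
  by_cases h : i ∈ s
  · simp only [extendBy, h, dite_true]
    exact contDiff_apply ℝ ℝ _
  · simp only [extendBy, h, dite_false]
    exact contDiff_const

/-- The section `extendBy 0 s` of `proj s` as a linear map. -/
def extendByZero {ι : Type} (s : Finset ι) : (s → ℝ) →ₗ[ℝ] (ι → ℝ) where
  toFun := extendBy 0 s
  map_add' q q' := by
    funext i
    by_cases h : i ∈ s <;> simp [extendBy, h]
  map_smul' a q := by
    funext i
    by_cases h : i ∈ s <;> simp [extendBy, h]

/-- Near `y₀`, the integrand depends on finitely many coordinates, uniformly over the fibre. -/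
theorem IsSmoothForm.exists_finset_fiberIntegrand {U : TopologicalSpace.Opens ℝ}
    {φ : FormField (idx r) 2} (hφ : IsSmoothForm {x | coord _ 0 x ∈ U} φ) {y₀ : idxGL r → ℝ}
    (hy₀ : coord _ 0 y₀ ∈ U) :
    ∃ (s : Finset (idxGL r)) (V : Set (s → ℝ)), IsOpen V ∧ proj s y₀ ∈ V ∧
      ∀ y y', coord _ 0 y ∈ U → coord _ 0 y' ∈ U → proj s y ∈ V → proj s y = proj s y' →
        ∀ w w', proj s w = proj s w' → ∀ t ∈ Set.Icc (0 : ℝ) 1,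
          fiberIntegrand φ y w t = fiberIntegrand φ y' w' t := by
  classical
  -- Compact induction: the property passes to subsets and to finite unions (take the union of the
  -- finite sets of coordinates), so it need only hold near each `t₀`.
  refine isCompact_Icc.induction_on (p := fun K => ∃ (s : Finset (idxGL r)) (V : Set (s → ℝ)),
    IsOpen V ∧ proj s y₀ ∈ V ∧
      ∀ y y', coord _ 0 y ∈ U → coord _ 0 y' ∈ U → proj s y ∈ V → proj s y = proj s y' →
        ∀ w w', proj s w = proj s w' → ∀ t ∈ K,
          fiberIntegrand φ y w t = fiberIntegrand φ y' w' t) ?_ ?_ ?_ ?_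
  · exact ⟨∅, Set.univ, isOpen_univ, trivial, fun _ _ _ _ _ _ _ _ _ _ ht => ht.elim⟩
  · rintro K K' hK ⟨s, V, hV, h0, h⟩
    exact ⟨s, V, hV, h0, fun y y' hy hy' hyV e w w' ew t ht =>
      h y y' hy hy' hyV e w w' ew t (hK ht)⟩
  · rintro K K' ⟨s, V, hV, h0, h⟩ ⟨s', V', hV', h0', h'⟩
    let a : ((s ∪ s' : Finset (idxGL r)) → ℝ) →ₗ[ℝ] (s → ℝ) :=
      LinearMap.funLeft ℝ ℝ (fun i => ⟨i, Finset.mem_union_left _ i.2⟩)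
    let b : ((s ∪ s' : Finset (idxGL r)) → ℝ) →ₗ[ℝ] (s' → ℝ) :=
      LinearMap.funLeft ℝ ℝ (fun i => ⟨i, Finset.mem_union_right _ i.2⟩)
    have ha : Continuous a := a.continuous_of_finiteDimensional
    have hb : Continuous b := b.continuous_of_finiteDimensional
    refine ⟨s ∪ s', a ⁻¹' V ∩ b ⁻¹' V', (hV.preimage ha).inter (hV'.preimage hb), ⟨h0, h0'⟩,
      fun y y' hy hy' hyV e w w' ew t ht => ?_⟩
    rcases ht with ht | ht
    · exact h y y' hy hy' hyV.1 (congrArg a e) w w' (congrArg a ew) t ht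
    · exact h' y y' hy hy' hyV.2 (congrArg b e) w w' (congrArg b ew) t ht
  · intro t₀ _
    obtain ⟨s, V, η, hV, hxV, -, h⟩ := hφ (fiberPoint y₀ t₀)
      (by simpa only [Set.mem_ofPred_eq, coord_fiberPoint zero_ne_one] using hy₀)
    let inc : idxGL r → idx r := fun i => ⟨i, i.2.1⟩
    have hinc : Function.Injective inc := fun i j hij =>
    Subtype.ext (congrArg (fun x : idx r => (x : ℕ)) hij)
    -- The indices of `s` other than `1`; the coordinate `x₁` is the fibre variable `t`.
    let s' : Finset (idxGL r) := s.preimage inc hinc.injOn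
    have hdep : ∀ y y' : idxGL r → ℝ, proj s' y = proj s' y' →
        ∀ t, proj s (fiberPoint y t) = proj s (fiberPoint y' t) := by
      intro y y' e t
      funext i
      simp only [proj, LinearMap.funLeft_apply, fiberPoint_apply]
      split_ifs with hi
      · rfl
      · have hi' : ((i : idx r) : ℕ) ∈ idxGL r := ⟨i.1.2, hi⟩
        rw [coord_of_mem hi', coord_of_mem hi']
        exact congrFun e ⟨⟨_, hi'⟩, Finset.mem_preimage.2 i.2⟩
    have hcont : Continuous fun z : (s' → ℝ) × ℝ => proj s (fiberPoint (extendBy y₀ s' z.1) z.2) :=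
      continuous_pi fun i => (contDiff_fiberPoint
        (fun j => (contDiff_extendBy y₀ s' j).comp contDiff_fst) contDiff_snd _).continuous
    -- Freezing the coordinates outside `s'` at those of `y₀` makes the condition an open one on a
    -- finite-dimensional space; a product neighbourhood then separates `y` from `t`.
    have hN : (fun z : (s' → ℝ) × ℝ => proj s (fiberPoint (extendBy y₀ s' z.1) z.2)) ⁻¹' V ∈
        𝓝 (proj s' y₀, t₀) := by
      refine (hV.preimage hcont).mem_nhds ?_
      simpa only [Set.mem_preimage, extendBy_proj] using hxV
    obtain ⟨V', T, hV', hy₀V', hT, htT, hsub⟩ := mem_nhds_prod_iff'.1 hN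
    refine ⟨T, mem_nhdsWithin_of_mem_nhds (hT.mem_nhds htT), s', V', hV', hy₀V',
      fun y y' hy hy' hyV e w w' ew t ht => ?_⟩
    have hm : proj s (fiberPoint y t) ∈ V := by
      have := hsub (Set.mk_mem_prod hyV ht)
      rwa [Set.mem_preimage, hdep _ y (proj_extendBy _ _ _)] at this
    have e1 := hdep _ _ e t
    -- At `t = 0` the point `fiberPoint w 0` is `dSectionGL w`, so the statement for points also
    -- covers tangent vectors.
    have e2 : proj s (dSectionGL w) = proj s (dSectionGL w') := by
      simpa [fiberPoint] using hdep _ _ ew 0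
    simp only [fiberIntegrand]
    rw [h _ (by simpa only [Set.mem_ofPred_eq, coord_fiberPoint zero_ne_one] using hy) hm,
      h _ (by simpa only [Set.mem_ofPred_eq, coord_fiberPoint zero_ne_one] using hy') (e1 ▸ hm), e1]
    simp only [AlternatingMap.compLinearMap_apply]
    congr 1
    funext i
    fin_cases i
    · rfl
    · exact e2

theorem IsSmoothForm.fiberIntegral {U : TopologicalSpace.Opens ℝ} {φ : FormField (idx r) 2}
    (hφ : IsSmoothForm {x | coord _ 0 x ∈ U} φ)
    (hc : ∀ y w, Continuous (fiberIntegrand φ y w)) :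
    IsSmoothForm {y | coord _ 0 y ∈ U} (fiberIntegral φ hc) := by
  intro y₀ hy₀
  obtain ⟨s, V, hV, h0, h⟩ := hφ.exists_finset_fiberIntegrand hy₀
  have hcE : Continuous fun q => coord _ 0 (extendBy y₀ s q) :=
    (continuous_coord _ 0).comp (continuous_pi fun i => (contDiff_extendBy y₀ s i).continuous)
  -- The form on `ℝ^s` is the fibre integral at the point completed by the coordinates of `y₀`, on
  -- vectors completed by `0`. The choice of completion does not affect the integrand on `[0, 1]`;
  -- the second set keeps the completed point over `U`.
  refine ⟨s, V ∩ {q | coord _ 0 (extendBy y₀ s q) ∈ U},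
    fun q => (Losik.fiberIntegral φ hc (extendBy y₀ s q)).compLinearMap (extendByZero s),
    hV.inter (U.isOpen.preimage hcE),
    ⟨h0, by simpa only [Set.mem_ofPred_eq, extendBy_proj] using hy₀⟩, fun v => ?_, ?_⟩
  · exact contDiffOn_integral_slice
      (Ω := {z : (s → ℝ) × ℝ | coord _ 0 (extendBy y₀ s z.1) ∈ U})
      (U.isOpen.preimage (hcE.comp continuous_fst)) (hV.inter (U.isOpen.preimage hcE))
      (fun q hq t _ => hq.2)
      (hφ.contDiffOn_fiberIntegrand (contDiff_extendBy y₀ s) (extendByZero s (v 0)))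
  · intro y hy hyV
    ext v
    simp only [AlternatingMap.compLinearMap_apply, fiberIntegral_apply]
    refine intervalIntegral.integral_congr fun t ht => ?_
    rw [Set.uIcc_of_le zero_le_one] at ht
    exact h _ _ hy hyV.2 hyV.1 (proj_extendBy _ _ _).symm _ _ (proj_extendBy _ _ _).symm t ht

/-- The exterior derivative anticommutes with the integration over the fibres of a form that takes
the same values at the two ends of each fibre. -/
theorem extD_fiberIntegral {U : TopologicalSpace.Opens ℝ} {φ : FormField (idx r) 2}
    (hφ : IsSmoothForm {x | coord _ 0 x ∈ U} φ)
    (hc : ∀ y w, Continuous (fiberIntegrand φ y w)) {y : idxGL r → ℝ} (hy : coord _ 0 y ∈ U)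
    (hper : ∀ v, φ (fiberPoint y 1) v = φ (fiberPoint y 0) v) (v : Fin 2 → idxGL r → ℝ) :
    extD (fiberIntegral φ hc) y v =
      -∫ t in (0 : ℝ)..1, extD φ (fiberPoint y t)
        ![vertical, dSectionGL (v 0), dSectionGL (v 1)] := by
  have hW := isOpen_preimage_coord (idx r) U
  have hmem : ∀ t, coord _ 0 (fiberPoint y t) ∈ U := fun t => by
    rwa [coord_fiberPoint zero_ne_one]
  have hline : ∀ w w' : idxGL r → ℝ,
      IntervalIntegrable (fun t => deriv (fun x : ℝ => fiberIntegrand φ (y + x • w) w' t) 0)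
        MeasureTheory.volume 0 1 ∧
      lineDeriv ℝ (fun y => ∫ t in (0 : ℝ)..1, fiberIntegrand φ y w' t) y w =
        ∫ t in (0 : ℝ)..1, deriv (fun x : ℝ => fiberIntegrand φ (y + x • w) w' t) 0 := by
    intro w w'
    have ha : ∀ i, ContDiff ℝ ∞ fun x : ℝ => (y + x • w) i := fun i => by
      simp only [Pi.add_apply, Pi.smul_apply, smul_eq_mul]
      fun_prop
    have hΩ : IsOpen {z : ℝ × ℝ | coord _ 0 (y + z.1 • w) ∈ U} :=
      U.isOpen.preimage ((continuous_coord _ 0).comp (by fun_prop))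
    have h := hasDerivAt_integral_slice hΩ (hφ.contDiffOn_fiberIntegrand ha w') (q := 0)
      fun t _ => by simpa using hy
    exact ⟨h.1, h.2.deriv⟩
  obtain ⟨i01, e01⟩ := hline (v 0) (v 1)
  obtain ⟨i10, e10⟩ := hline (v 1) (v 0)
  obtain ⟨u, hu⟩ : ∃ u : Fin 2 → idx r → ℝ, u = ![dSectionGL (v 0), dSectionGL (v 1)] := ⟨_, rfl⟩
  have hsm : ContDiff ℝ ∞ fun t : ℝ => φ (fiberPoint y t) u := by
    have h := hφ.contDiffOn_comp hW
      (contDiff_fiberPoint (E := ℝ) (a := fun _ => y) (fun i => contDiff_const) contDiff_id) u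
    exact contDiffOn_univ.1 (h.mono fun t _ => hmem t)
  have iv : IntervalIntegrable (deriv fun t : ℝ => φ (fiberPoint y t) u)
      MeasureTheory.volume 0 1 :=
    (hsm.continuous_deriv (by simp)).intervalIntegrable _ _
  -- The boundary term: the values at the two ends of the fibre agree.
  have ev : ∫ t in (0 : ℝ)..1, deriv (fun t : ℝ => φ (fiberPoint y t) u) t = 0 := by
    rw [intervalIntegral.integral_eq_sub_of_hasDerivAt
      (fun t _ => ((hsm.differentiable (by simp)) t).hasDerivAt) iv, hper, sub_self]
  -- The derivative along the fibre integrates to `0`. The other two terms are those of `extD` of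
  -- the fibre integral with opposite signs, whence the minus sign in the conclusion.
  have hext : ∀ t, extD φ (fiberPoint y t) ![vertical, dSectionGL (v 0), dSectionGL (v 1)] =
      deriv (fun t : ℝ => φ (fiberPoint y t) u) t -
        deriv (fun x : ℝ => fiberIntegrand φ (y + x • v 0) (v 1) t) 0 +
        deriv (fun x : ℝ => fiberIntegrand φ (y + x • v 1) (v 0) t) 0 := by
    intro t
    have r0 : (0 : Fin 3).removeNth ![vertical (r := r), dSectionGL (v 0), dSectionGL (v 1)] =
        u := by
      rw [hu]
      funext i
      fin_cases i <;> rfl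
    have r1 : (1 : Fin 3).removeNth ![vertical (r := r), dSectionGL (v 0), dSectionGL (v 1)] =
        ![vertical, dSectionGL (v 1)] := by
      funext i
      fin_cases i <;> rfl
    have r2 : (2 : Fin 3).removeNth ![vertical (r := r), dSectionGL (v 0), dSectionGL (v 1)] =
        ![vertical, dSectionGL (v 0)] := by
      funext i
      fin_cases i <;> rfl
    have hv : lineDeriv ℝ (fun x => φ x u) (fiberPoint y t) vertical =
        deriv (fun t : ℝ => φ (fiberPoint y t) u) t := by
      rw [lineDeriv]
      simp only [fiberPoint_add_smul_vertical]
      rw [deriv_comp_const_add (f := fun t => φ (fiberPoint y t) u), add_zero]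
    rw [extD, Fin.sum_univ_three, r0, r1, r2]
    simp only [Matrix.cons_val_zero, Matrix.cons_val_one, Matrix.cons_val, hv]
    simp only [lineDeriv, fiberPoint_add_smul, fiberIntegrand]
    norm_num
    ring
  simp only [hext]
  rw [intervalIntegral.integral_add (iv.sub i01) i10, intervalIntegral.integral_sub iv i01, ev,
    ← e01, ← e10, extD, Fin.sum_univ_two]
  have s0 : (0 : Fin 2).removeNth v 0 = v 1 := rfl
  have s1 : (1 : Fin 2).removeNth v 0 = v 0 := rfl
  simp only [fiberIntegral_apply, s0, s1]
  norm_num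
  ring

/-! ### The Godbillon–Vey–Losik class and the first Chern–Losik class -/

/-- Invariance under `ℤ` is periodicity in `x₁`, since a translation has the identity as its tangent
map. -/
theorem fiberPoint_add_int_of_mem_forms {X : Type*} {D : D1Space X} {k : ℕ}
    {β : FormFamily (quotOZ D r) k} (hβ : β ∈ Forms (quotOZ D r) k) (c : D.atlas)
    {y : idxGL r → ℝ} (hy : coord _ 0 y ∈ c.1.dom) (t : ℝ) (n : ℤ) :
    β c (fiberPoint y (t + n)) = β c (fiberPoint y t) := by
  ext v
  have hT : ∀ w : idx r → ℝ, tangentMap (fun x => shift n x) (fiberPoint y t) w = w := by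
    intro w
    funext p
    simp only [tangentMap, lineDeriv, shift]
    split_ifs
    · simp
    · simp
  have h := hβ.2.2 c c _ ⟨_, isChartMorphism_id c.1, n, rfl⟩ (fiberPoint y t)
    (by change coord _ 0 _ ∈ c.1.dom; rwa [coord_fiberPoint zero_ne_one]) v
  simpa only [pullbackForm, hT, mapO_id, shift_fiberPoint] using h

theorem continuous_fiberIntegrand_of_mem_forms {X : Type*} {D : D1Space X}
    {β : FormFamily (quotOZ D r) 2} (hβ : β ∈ Forms (quotOZ D r) 2) (c : D.atlas)
    (y w : idxGL r → ℝ) : Continuous (fiberIntegrand (β c) y w) :=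
  IsSmoothForm.continuous_fiberIntegrand (U := c.1.dom) (hβ.1 c) (hβ.2.1 c) y w

/-- The fibre integral of a form on `S''(X)/ℤ`. -/
def fiberIntegralFamily {X : Type*} {D : D1Space X} {β : FormFamily (quotOZ D r) 2}
    (hβ : β ∈ Forms (quotOZ D r) 2) : FormFamily (quotGL D r) 1 := fun c =>
  fiberIntegral (β c) (continuous_fiberIntegrand_of_mem_forms hβ c)

/-- For the naturality, a morphism of charts changes the integrand only by a translation of `t`, and
the integral of a function of period one over an interval of length one does not notice it. -/
theorem fiberIntegralFamily_mem (hr : 2 ≤ r) {X : Type*} {D : D1Space X}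
    {β : FormFamily (quotOZ D r) 2} (hβ : β ∈ Forms (quotOZ D r) 2) :
    fiberIntegralFamily hβ ∈ Forms (quotGL D r) 1 := by
  refine ⟨fun c => IsSmoothForm.fiberIntegral (U := c.1.dom) (hβ.1 c) _, fun c y hy => ?_, ?_⟩
  · ext v
    simp only [fiberIntegralFamily, fiberIntegral_apply, fiberIntegrand,
      AlternatingMap.zero_apply]
    have e : ∀ t, β c (fiberPoint y t) = 0 := fun t => by
      refine hβ.2.1 c _ ?_
      change coord _ 0 _ ∉ c.1.dom
      rwa [coord_fiberPoint zero_ne_one]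
    simp [e]
  · rintro c c' F ⟨m, hm, rfl⟩ y hy v
    have hy' : coord _ 0 y ∈ c.1.dom := hy
    have hself : ∀ f : (idx r → ℝ) [⋀^Fin 2]→ₗ[ℝ] ℝ, f ![vertical, vertical] = 0 := fun f =>
      f.map_eq_zero_of_eq _ (i := 0) (j := 1) rfl (by decide)
    set l := Real.log (deriv m (coord _ 0 y))
    set w := tangentMap (mapGL m) y (v 0)
    have key : ∀ t, fiberIntegrand (β c) y (v 0) t =
        fiberIntegrand (β c') (mapGL m y) w (t + l) := by
      intro t
      -- The morphism over `m` with trivial shift `n = 0`.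
      have hF : mapO (r := r) m ∈ (quotOZ D r).Mor c c' := by
        refine ⟨m, hm, 0, ?_⟩
        funext x p
        simp [shift]
      obtain ⟨a, ha⟩ := tangentMap_mapO_dSectionGL hr m y t (v 0)
      have h := hβ.2.2 c c' _ hF (fiberPoint y t)
        (by change coord _ 0 _ ∈ c.1.dom; rwa [coord_fiberPoint zero_ne_one])
        ![vertical, dSectionGL (v 0)]
      have e : (fun i => tangentMap (mapO m) (fiberPoint y t)
          ((![vertical, dSectionGL (v 0)] : Fin 2 → idx r → ℝ) i)) =
          ![vertical, dSectionGL w + a • vertical] := by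
        funext i
        fin_cases i
        · exact tangentMap_mapO_vertical hr hm.etale hy' t
        · exact ha
      -- The vertical error `a • vertical` of the lifted vector drops out by `hself`.
      rw [pullbackForm, e, mapO_fiberPoint hr hm.etale hy', AlternatingMap.map_pair_add,
        AlternatingMap.map_pair_smul, hself, mul_zero, add_zero] at h
      exact h.symm
    have hper : Function.Periodic (fiberIntegrand (β c') (mapGL m y) w) 1 := fun t => by
      have h := fiberPoint_add_int_of_mem_forms hβ c' (y := mapGL m y)
        (by rw [coord_mapGL_zero]; exact hm.etale.mapsTo _ hy') t 1
      rw [Int.cast_one] at h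
      rw [fiberIntegrand, h, fiberIntegrand]
    change ∫ t in (0 : ℝ)..1, fiberIntegrand (β c') (mapGL m y) w t =
      ∫ t in (0 : ℝ)..1, fiberIntegrand (β c) y (v 0) t
    simp only [key]
    rw [intervalIntegral.integral_comp_add_right, zero_add, add_comm (1 : ℝ) l,
      hper.intervalIntegral_add_eq l 0, zero_add]

/-- Contraction with `∂/∂x₁` moves past the factor `dx₀`, so `-dx₀ ∧ dx₁ ∧ dx₂` becomes `dx₀ ∧ dx₂ =
-dx₂ ∧ dx₀`. The result does not depend on `t`, so it equals its own integral over a fibre. -/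
theorem gvl_fiberPoint {X : Type*} (D : D1Space X) (hr : 2 ≤ r) (c : D.atlas)
    {y : idxGL r → ℝ} (hy : coord _ 0 y ∈ c.1.dom) (t : ℝ) (v : Fin 2 → idxGL r → ℝ) :
    gvl D r c (fiberPoint y t) ![vertical, dSectionGL (v 0), dSectionGL (v 1)] =
      -cl D r c y v := by
  have h : fiberPoint y t ∈ {x : idx r → ℝ | coord _ 0 x ∈ c.1.dom} := by
    rwa [Set.mem_ofPred_eq, coord_fiberPoint zero_ne_one]
  have hg : gvl D r c (fiberPoint y t) = gvlField (fiberPoint y t) := Set.indicator_of_mem h _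
  have hl : cl D r c y = clField y :=
    Set.indicator_of_mem (s := {x : idxGL r → ℝ | coord _ 0 x ∈ c.1.dom}) hy _
  rw [hg, hl, gvlField_eq hr, clField_eq hr, AlternatingMap.neg_apply, wedge_apply, wedge_apply,
    Matrix.det_fin_three, Matrix.det_fin_two]
  simp [coord_vertical, coord_vertical_one hr, coord_dSectionGL]
  ring

theorem CL₁_eq_zero_of_GVL_eq_zero {X : Type*} (D : D1Space X) (hr : 2 ≤ r)
    (h : GVL D r hr = 0) : CL₁ D r hr = 0 := by
  obtain ⟨-, β, hβ, hd⟩ := (Submodule.Quotient.mk_eq_zero _).1 h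
  refine (Submodule.Quotient.mk_eq_zero _).2
    ⟨(cl_mem D hr).1, fiberIntegralFamily hβ, fiberIntegralFamily_mem hr hβ, fun c y hy v => ?_⟩
  have hy' : coord _ 0 y ∈ c.1.dom := hy
  have hper : ∀ w, β c (fiberPoint y 1) w = β c (fiberPoint y 0) w := fun w => by
    have h := fiberPoint_add_int_of_mem_forms hβ c hy' 0 1
    rw [Int.cast_one, zero_add] at h
    rw [h]
  rw [fiberIntegralFamily, extD_fiberIntegral (U := c.1.dom) (hβ.1 c) _ hy' hper]
  -- This minus sign cancels the one in `extD_fiberIntegral`, so the fibre integral of `β` itself is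
  -- the primitive.
  have e : ∀ t, extD (β c) (fiberPoint y t) ![vertical, dSectionGL (v 0), dSectionGL (v 1)] =
      -cl D r c y v := fun t => by
    rw [hd c _ (by change coord _ 0 _ ∈ c.1.dom; rwa [coord_fiberPoint zero_ne_one])]
    exact gvl_fiberPoint D hr c hy' t v
  simp [e]

end Losik

end

theorem mainTheorem11 {X : Type*} (D : Losik.D1Space X) :
    (Losik.GVL D ⊤ le_top = 0 → Losik.CL₁ D ⊤ le_top = 0) ∧
      (Losik.GVL D 2 le_rfl = 0 → Losik.CL₁ D 2 le_rfl = 0) :=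
  ⟨Losik.CL₁_eq_zero_of_GVL_eq_zero D le_top, Losik.CL₁_eq_zero_of_GVL_eq_zero D le_rfl⟩
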